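/- **Proposition 3.3 (Codazzi for a given immersion).** Let $N\ge 2$, $0\le\lambda\le N$, $c,\varepsilon\in\{-1,1\}$. Let $\mathbb{M}^N_\lambda(c)$ be a connected component of the hyperquadric $\{p : g_0(p,p)=c\}$ of the pseudo-Euclidean space $(\mathbb{R}^{N+1},g_0)$ of index $\lambda$ if $c=1$ and of index $\lambda+1$ if $c=-1$, with the induced metric $g_{\mathbb M}$ (of index $\lambda$). Let $I\subset\mathbb{R}$ be an open interval, $a:I\to(0,\infty)$ a smooth function, and let $\bar P=\varepsilon I\times_a\mathbb{M}^N_\lambda(c)$ be the manifold $I\times\mathbb{M}^N_\lambda(c)$ with the metric $\langle\,,\rangle=\varepsilon\,dt^2+a(t)^2g_{\mathbb M}$. Let $(M^n,\langle\,,\rangle)$ be a semi-Riemannian manifold and $f:M\to\bar P$ an isometric immersion, let $\bar\nabla$ and $\nabla$ be the Levi-Civita connections of $\bar P$ and $M$ ($\bar\nabla$ also denotes the induced derivative of vector fields along $f$), and let $\nabla^\perp$ be the normal connection and $\alpha(X,Z)=(\bar\nabla_X\,df(Z))^\perp$ the second fundamental form of $f$. Let $\pi:M\to I$ be the first component of $f$,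 and put $T=\varepsilon\,\mathrm{grad}(\pi)$ and $\xi=\partial t-T$, a normal field along $f$ (tangent vectors of $M$ are identified with their images under $df$). For vector fields $X,Y,Z$ on $M$ and a normal field $\eta$, all smooth (possibly only locally defined), let $$(\bar\nabla_Y\alpha)(X,Z,\eta)=Y\langle\alpha(X,Z),\eta\rangle-\langle\alpha(\nabla_YX,Z),\eta\rangle-\langle\alpha(X,\nabla_YZ),\eta\rangle-\langle\alpha(X,Z),\nabla^\perp_Y\eta\rangle .$$ Then, with $a,a',a''$ evaluated at $\pi$, $$(\bar\nabla_Y\alpha)(X,Z,\eta)-(\bar\nabla_X\alpha)(Y,Z,\eta)=\left(\frac{a''}{a}-\frac{(a')^2}{a^2}+\frac{\varepsilon c}{a^2}\right)\langle\xi,\eta\rangle\big(\langle T,X\rangle\langle Y,Z\rangle-\langle T,Y\rangle\langle X,Z\rangle\big).$$ -/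

import Mathlib

open Set Module
open scoped Manifold ContDiff Topology

noncomputable section

namespace WarpedCodazzi

/-! ### The pseudo-Euclidean space and its central hyperquadrics -/

/-- The underlying vector space of the pseudo-Euclidean space of dimension `N + 1`. -/
abbrev Ambient (N : ℕ) : Type := EuclideanSpace ℝ (Fin (N + 1))

/-- The flat metric of index `ν` on `ℝ^{N+1}`: the coordinates `x_0, …, x_{N-ν}` carry the
sign `+1` and the last `ν` coordinates the sign `-1`. -/
def flatMetric (N ν : ℕ) : Ambient N →L[ℝ] Ambient N →L[ℝ] ℝ :=
  ∑ i : Fin (N + 1), (if (i : ℕ) + ν < N + 1 then (1 : ℝ) else -1) •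
    (EuclideanSpace.proj i : Ambient N →L[ℝ] ℝ).smulRight
      (EuclideanSpace.proj i : Ambient N →L[ℝ] ℝ)

theorem flatMetric_apply (N ν : ℕ) (x y : Ambient N) :
    flatMetric N ν x y =
      ∑ i : Fin (N + 1), (if (i : ℕ) + ν < N + 1 then (1 : ℝ) else -1) * (x i * y i) := by
  simp only [flatMetric, sum_apply, smul_apply,
    ContinuousLinearMap.smulRight_apply, smul_eq_mul]
  rfl

theorem flatMetric_symm (N ν : ℕ) (x y : Ambient N) :
    flatMetric N ν x y = flatMetric N ν y x := by
  simp only [flatMetric_apply, mul_comm (x _)]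

/-- The hyperquadric `{x ; g₀(x, x) = c}`, `c = ±1`, of the pseudo-Euclidean space of dimension
`N + 1` and index `ν`. -/
@[ext]
structure Quadric (N ν : ℕ) (c : ℤˣ) where
  val : Ambient N
  self_eq : flatMetric N ν val val = ((c : ℤ) : ℝ)

instance (N ν : ℕ) (c : ℤˣ) : CoeOut (Quadric N ν c) (Ambient N) := ⟨Quadric.val⟩

/-- The hyperquadric carries the subspace topology. -/
instance (N ν : ℕ) (c : ℤˣ) : TopologicalSpace (Quadric N ν c) :=
  TopologicalSpace.induced Quadric.val inferInstance

variable {N ν : ℕ} {c : ℤˣ}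

theorem sign_mul_self (c : ℤˣ) : ((c : ℤ) : ℝ) * ((c : ℤ) : ℝ) = 1 := by
  rcases Int.units_eq_one_or c with rfl | rfl <;> simp

theorem Quadric.isInducing_val : Topology.IsInducing (Quadric.val : Quadric N ν c → Ambient N) :=
  ⟨rfl⟩

@[fun_prop]
theorem Quadric.continuous_val : Continuous (Quadric.val : Quadric N ν c → Ambient N) :=
  Quadric.isInducing_val.continuous

/-- A linear identification of `ℝ^N` with the `g₀`-orthogonal complement of a point `p` of the
hyperquadric. -/
def Quadric.perpEquiv (p : Quadric N ν c) :
    LinearMap.ker (flatMetric N ν (p : Ambient N) : Ambient N →ₗ[ℝ] ℝ) ≃L[ℝ]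
      EuclideanSpace ℝ (Fin N) :=
  ContinuousLinearEquiv.ofFinrankEq (by
    have hne : (flatMetric N ν (p : Ambient N) : Ambient N →ₗ[ℝ] ℝ) ≠ 0 := by
      intro h
      have h1 := p.self_eq
      have h2 : flatMetric N ν (p : Ambient N) (p : Ambient N) = 0 :=
        LinearMap.congr_fun h (p : Ambient N)
      have h3 := sign_mul_self c
      rw [← h1, h2] at h3
      simp at h3
    have h := Module.Dual.finrank_ker_add_one_of_ne_zero (K := ℝ) hne
    simp only [finrank_euclideanSpace, Fintype.card_fin] at h ⊢
    omega)

/-- The `g₀`-orthogonal projection `x ↦ x - c g₀(p, x) p` onto `p^⊥`, read in `ℝ^N`. -/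
def Quadric.toPerp (p : Quadric N ν c) : Ambient N →L[ℝ] EuclideanSpace ℝ (Fin N) :=
  (p.perpEquiv : _ →L[ℝ] EuclideanSpace ℝ (Fin N)).comp
    ((ContinuousLinearMap.id ℝ (Ambient N) -
      (((c : ℤ) : ℝ) • (flatMetric N ν (p : Ambient N))).smulRight (p : Ambient N)).codRestrict
      (LinearMap.ker (flatMetric N ν (p : Ambient N) : Ambient N →ₗ[ℝ] ℝ)) (by
        intro x
        have h3 := sign_mul_self c
        have h1 := p.self_eq
        simp only [LinearMap.mem_ker, ContinuousLinearMap.coe_coe,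
          sub_apply, ContinuousLinearMap.id_apply,
          ContinuousLinearMap.smulRight_apply, smul_apply, map_sub, map_smul,
          smul_eq_mul, h1]
        linear_combination (-flatMetric N ν (p : Ambient N) x) * h3))

/-- The inclusion of `p^⊥`, read in `ℝ^N`, into the ambient space. -/
def Quadric.ofPerp (p : Quadric N ν c) : EuclideanSpace ℝ (Fin N) →L[ℝ] Ambient N :=
  (LinearMap.ker (flatMetric N ν (p : Ambient N) : Ambient N →ₗ[ℝ] ℝ)).subtypeL.comp
    (p.perpEquiv.symm : EuclideanSpace ℝ (Fin N) →L[ℝ] _)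

theorem Quadric.flatMetric_ofPerp (p : Quadric N ν c) (y : EuclideanSpace ℝ (Fin N)) :
    flatMetric N ν (p : Ambient N) (p.ofPerp y) = 0 :=
  (p.perpEquiv.symm y).2

theorem Quadric.ofPerp_toPerp (p : Quadric N ν c) (x : Ambient N) :
    p.ofPerp (p.toPerp x) =
      x - (((c : ℤ) : ℝ) * flatMetric N ν (p : Ambient N) x) • (p : Ambient N) := by
  simp [Quadric.ofPerp, Quadric.toPerp]

theorem Quadric.toPerp_ofPerp (p : Quadric N ν c) (y : EuclideanSpace ℝ (Fin N)) :
    p.toPerp (p.ofPerp y) = y := by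
  rw [Quadric.toPerp, ContinuousLinearMap.comp_apply, ContinuousLinearEquiv.coe_coe,
    ← ContinuousLinearEquiv.eq_symm_apply]
  apply Subtype.ext
  simp [ContinuousLinearMap.coe_codRestrict_apply, p.flatMetric_ofPerp y]
  rfl

theorem Quadric.toPerp_self (p : Quadric N ν c) : p.toPerp (p : Ambient N) = 0 := by
  have h : p.ofPerp (p.toPerp (p : Ambient N)) = 0 := by
    rw [p.ofPerp_toPerp, p.self_eq, sign_mul_self, one_smul, sub_self]
  rw [← p.toPerp_ofPerp (p.toPerp (p : Ambient N)), h, map_zero]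

/-- The function `1 - c g₀(y, y)` on `p^⊥`. -/
def Quadric.height (p : Quadric N ν c) (y : EuclideanSpace ℝ (Fin N)) : ℝ :=
  1 - ((c : ℤ) : ℝ) * flatMetric N ν (p.ofPerp y) (p.ofPerp y)

theorem Quadric.contDiff_height (p : Quadric N ν c) {k : ℕ∞ω} : ContDiff ℝ k p.height := by
  unfold Quadric.height
  have h1 : ContDiff ℝ k fun y => p.ofPerp y := p.ofPerp.contDiff
  have h2 : ContDiff ℝ k fun y => flatMetric N ν (p.ofPerp y) :=
    ((flatMetric N ν).comp p.ofPerp).contDiff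
  exact contDiff_const.sub (contDiff_const.mul (h2.clm_apply h1))

/-- The point `y + √(1 - c g₀(y, y)) p` of the hyperquadric lying over `y ∈ p^⊥`. -/
def Quadric.lift (p : Quadric N ν c) (y : EuclideanSpace ℝ (Fin N)) : Ambient N :=
  p.ofPerp y + √(p.height y) • (p : Ambient N)

theorem Quadric.lift_mem (p : Quadric N ν c) (y : EuclideanSpace ℝ (Fin N))
    (hy : 0 ≤ p.height y) : flatMetric N ν (p.lift y) (p.lift y) = ((c : ℤ) : ℝ) := by
  have h0 := p.flatMetric_ofPerp y
  have h0' : flatMetric N ν (p.ofPerp y) (p : Ambient N) = 0 := by rw [flatMetric_symm, h0]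
  have h1 := p.self_eq
  have h2 := Real.mul_self_sqrt hy
  have h3 := sign_mul_self c
  simp only [Quadric.lift, map_add, map_smul,
    add_apply, smul_apply, smul_eq_mul, h0, h0', h1]
  have h4 : p.height y = 1 - ((c : ℤ) : ℝ) * flatMetric N ν (p.ofPerp y) (p.ofPerp y) := rfl
  rw [h4] at h2 ⊢
  linear_combination ((c : ℤ) : ℝ) * h2 - flatMetric N ν (p.ofPerp y) (p.ofPerp y) * h3

theorem Quadric.flatMetric_lift (p : Quadric N ν c) (y : EuclideanSpace ℝ (Fin N)) :
    ((c : ℤ) : ℝ) * flatMetric N ν (p : Ambient N) (p.lift y) = √(p.height y) := by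
  have h3 := sign_mul_self c
  simp only [Quadric.lift, map_add, map_smul, smul_eq_mul, p.flatMetric_ofPerp y, p.self_eq]
  linear_combination √(p.height y) * h3

theorem Quadric.toPerp_lift (p : Quadric N ν c) (y : EuclideanSpace ℝ (Fin N)) :
    p.toPerp (p.lift y) = y := by
  simp [Quadric.lift, p.toPerp_ofPerp, p.toPerp_self]

theorem Quadric.height_toPerp (p x : Quadric N ν c) :
    p.height (p.toPerp (x : Ambient N)) =
      (((c : ℤ) : ℝ) * flatMetric N ν (p : Ambient N) (x : Ambient N)) ^ 2 := by
  have h3 := sign_mul_self c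
  simp only [Quadric.height, p.ofPerp_toPerp, map_sub, map_smul, sub_apply,
    smul_apply, smul_eq_mul, p.self_eq, x.self_eq,
    flatMetric_symm N ν (x : Ambient N) (p : Ambient N)]
  linear_combination (-1 - ((c : ℤ) : ℝ) ^ 2 *
    flatMetric N ν (p : Ambient N) (x : Ambient N) ^ 2) * h3

open Classical in
/-- The chart at `p`: the part `{x ; c g₀(p, x) > 0}` of the hyperquadric is a graph over an open
subset of `p^⊥` by orthogonal projection. -/
def Quadric.chart (p : Quadric N ν c) :
    OpenPartialHomeomorph (Quadric N ν c) (EuclideanSpace ℝ (Fin N)) where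
  toFun x := p.toPerp (x : Ambient N)
  invFun y := if hy : 0 < p.height y then ⟨p.lift y, p.lift_mem y hy.le⟩ else p
  source := {x | 0 < ((c : ℤ) : ℝ) * flatMetric N ν (p : Ambient N) (x : Ambient N)}
  target := {y | 0 < p.height y}
  map_source' := by
    intro x hx
    simp only [Set.mem_ofPred_eq] at hx ⊢
    rw [p.height_toPerp]
    positivity
  map_target' := by
    intro y hy
    simp only [Set.mem_ofPred_eq] at hy ⊢
    rw [dif_pos hy, p.flatMetric_lift]
    exact Real.sqrt_pos.2 hy
  left_inv' := by
    intro x hx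
    simp only [Set.mem_ofPred_eq] at hx
    have h : 0 < p.height (p.toPerp (x : Ambient N)) := by rw [p.height_toPerp]; positivity
    rw [dif_pos h]
    apply Quadric.ext
    simp only [Quadric.lift]
    rw [p.height_toPerp, Real.sqrt_sq hx.le, p.ofPerp_toPerp, sub_add_cancel]
  right_inv' := by
    intro y hy
    simp only [Set.mem_ofPred_eq] at hy
    rw [dif_pos hy]
    exact p.toPerp_lift y
  open_source := by
    apply isOpen_lt continuous_const
    fun_prop
  open_target := isOpen_lt continuous_const (p.contDiff_height (k := 0)).continuous
  continuousOn_toFun := by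
    apply Continuous.continuousOn
    fun_prop
  continuousOn_invFun := by
    rw [Quadric.isInducing_val.continuousOn_iff]
    have h : Continuous p.lift := by
      have := (p.contDiff_height (k := 0)).continuous
      unfold Quadric.lift
      fun_prop
    refine h.continuousOn.congr ?_
    intro y hy
    simp only [Set.mem_ofPred_eq] at hy
    simp [dif_pos hy]

instance Quadric.instChartedSpace :
    ChartedSpace (EuclideanSpace ℝ (Fin N)) (Quadric N ν c) where
  atlas := {e | ∃ p : Quadric N ν c, e = p.chart}
  chartAt p := p.chart
  mem_chart_source p := by
    simp [Quadric.chart, p.self_eq, sign_mul_self]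
  chart_mem_atlas p := ⟨p, rfl⟩

instance Quadric.instIsManifold : IsManifold (𝓡 N) ∞ (Quadric N ν c) :=
  isManifold_of_contDiffOn (𝓡 N) ∞ (Quadric N ν c) (by
    rintro _ _ ⟨p, rfl⟩ ⟨q, rfl⟩
    have key : ContDiffOn ℝ ∞ (fun y => q.toPerp (p.lift y)) {y | 0 < p.height y} := by
      apply q.toPerp.contDiff.comp_contDiffOn
      intro y hy
      unfold Quadric.lift
      refine (p.ofPerp.contDiff.contDiffAt.add
        (ContDiffAt.smul (ContDiffAt.sqrt p.contDiff_height.contDiffAt ?_)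
          contDiffAt_const)).contDiffWithinAt
      exact ne_of_gt hy
    refine (key.mono ?_).congr ?_
    · intro y hy
      exact hy.1.1
    · intro y hy
      have hy' : 0 < p.height y := hy.1.1
      simp [Quadric.chart, dif_pos hy'])

instance Quadric.instLocallyConnectedSpace : LocallyConnectedSpace (Quadric N ν c) :=
  ChartedSpace.locallyConnectedSpace (EuclideanSpace ℝ (Fin N)) (Quadric N ν c)

/-- The connected component, through the point `o`, of the hyperquadric. -/
def spaceForm (o : Quadric N ν c) : TopologicalSpace.Opens (Quadric N ν c) :=
  ⟨connectedComponent o, isOpen_connectedComponent⟩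

/-- The index of the pseudo-Euclidean space that contains the space form of index `l` and
constant curvature `c`: it is `l` if `c = 1` and `l + 1` if `c = -1`. -/
def ambientIndex (l : ℕ) (c : ℤˣ) : ℕ := if c = 1 then l else l + 1

/-- The bilinear form `(u, v) ↦ B(L u, L v)`. -/
def pullForm {V W : Type*} [AddCommGroup V] [Module ℝ V] [TopologicalSpace V]
    [IsTopologicalAddGroup V] [ContinuousSMul ℝ V]
    [AddCommGroup W] [Module ℝ W] [TopologicalSpace W]
    [IsTopologicalAddGroup W] [ContinuousSMul ℝ W]
    (B : W →L[ℝ] W →L[ℝ] ℝ) (L : V →L[ℝ] W) : V →L[ℝ] V →L[ℝ] ℝ :=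
  (ContinuousLinearMap.precomp ℝ L).comp (B.comp L)

theorem pullForm_apply {V W : Type*} [AddCommGroup V] [Module ℝ V] [TopologicalSpace V]
    [IsTopologicalAddGroup V] [ContinuousSMul ℝ V]
    [AddCommGroup W] [Module ℝ W] [TopologicalSpace W]
    [IsTopologicalAddGroup W] [ContinuousSMul ℝ W]
    (B : W →L[ℝ] W →L[ℝ] ℝ) (L : V →L[ℝ] W) (u v : V) :
    pullForm B L u v = B (L u) (L v) := rfl

/-- The metric that a space form inherits from the pseudo-Euclidean space. -/
def spaceFormMetric (o : Quadric N ν c) (p : spaceForm o) :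
    TangentSpace (𝓡 N) p →L[ℝ] TangentSpace (𝓡 N) p →L[ℝ] ℝ :=
  pullForm (flatMetric N ν)
    (mvfderiv (𝓡 N) (fun q : spaceForm o => ((q : Quadric N ν c) : Ambient N)) p)

/-! ### Warped products -/

section WarpedProduct

variable {E : Type*} [NormedAddCommGroup E] [NormedSpace ℝ E]
  {H : Type*} [TopologicalSpace H] (I : ModelWithCorners ℝ E H)
  {P : Type*} [TopologicalSpace P] [ChartedSpace H P]

/-- The metric `ε dt² + a(t)² g_P` on `J × P`, where `J` is an open subset of the line. -/
def warpedMetric (ε : ℤˣ) (J : TopologicalSpace.Opens ℝ) (a : ℝ → ℝ)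
    (gP : ∀ p : P, TangentSpace I p →L[ℝ] TangentSpace I p →L[ℝ] ℝ) (q : J × P) :
    TangentSpace (𝓘(ℝ, ℝ).prod I) q →L[ℝ] TangentSpace (𝓘(ℝ, ℝ).prod I) q →L[ℝ] ℝ :=
  ((ε : ℤ) : ℝ) •
      (mvfderiv (𝓘(ℝ, ℝ).prod I) (fun r : J × P => (r.1 : ℝ)) q).smulRight
        (mvfderiv (𝓘(ℝ, ℝ).prod I) (fun r : J × P => (r.1 : ℝ)) q) +
    (a q.1 ^ 2) •
      pullForm (gP q.2) (mfderiv (𝓘(ℝ, ℝ).prod I) I (Prod.snd : J × P → P) q)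

/-- The vector field `∂t` of a product `J × P`. -/
def partialT (J : TopologicalSpace.Opens ℝ) (q : J × P) :
    TangentSpace (𝓘(ℝ, ℝ).prod I) q :=
  ((1 : ℝ), (0 : E))

end WarpedProduct

/-- The metric `ε dt² + a(t)² g` of the warped product of the line (or an open subset `J` of it)
and the space form through `o`. -/
def ambientMetric (ε : ℤˣ) (J : TopologicalSpace.Opens ℝ) (a : ℝ → ℝ) (o : Quadric N ν c)
    (q : J × spaceForm o) :
    TangentSpace (𝓘(ℝ, ℝ).prod (𝓡 N)) q →L[ℝ] TangentSpace (𝓘(ℝ, ℝ).prod (𝓡 N)) q →L[ℝ] ℝ :=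
  warpedMetric (𝓡 N) ε J a (spaceFormMetric o) q

/-! ### Semi-Riemannian metrics and Levi-Civita connections -/

section Metric

variable {E : Type*} [NormedAddCommGroup E] [NormedSpace ℝ E] [FiniteDimensional ℝ E]
  {H : Type*} [TopologicalSpace H] (I : ModelWithCorners ℝ E H)
  (M : Type*) [TopologicalSpace M] [ChartedSpace H M] [IsManifold I ∞ M]

/-- A smooth semi-Riemannian metric on `M`: a smooth field of nondegenerate symmetric bilinear
forms on the tangent spaces. -/
structure SemiRiemannianMetric where
  inner : ∀ x : M, TangentSpace I x →L[ℝ] TangentSpace I x →L[ℝ] ℝ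
  symm : ∀ (x : M) (v w : TangentSpace I x), inner x v w = inner x w v
  nondegenerate : ∀ (x : M) (v : TangentSpace I x), (∀ w, inner x v w = 0) → v = 0
  contMDiff : ContMDiff I (I.prod 𝓘(ℝ, E →L[ℝ] E →L[ℝ] ℝ)) ∞
    (fun x => Bundle.TotalSpace.mk' (E →L[ℝ] E →L[ℝ] ℝ)
      (E := fun x : M => TangentSpace I x →L[ℝ] TangentSpace I x →L[ℝ] ℝ) x (inner x))

variable {I M}

/-- For a covector `φ`, there is exactly one tangent vector `u` with `⟨u, v⟩ = φ v` for all
`v`. -/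
theorem SemiRiemannianMetric.existsUnique_sharp (g : SemiRiemannianMetric I M) (x : M)
    (φ : TangentSpace I x →L[ℝ] ℝ) : ∃! u : TangentSpace I x, ∀ v, g.inner x u v = φ v := by
  have : FiniteDimensional ℝ (TangentSpace I x) := inferInstanceAs (FiniteDimensional ℝ E)
  let B : TangentSpace I x →ₗ[ℝ] Module.Dual ℝ (TangentSpace I x) :=
    { toFun := fun u => (g.inner x u : TangentSpace I x →ₗ[ℝ] ℝ)
      map_add' := fun u v => by ext w; simp
      map_smul' := fun r v => by ext w; simp }
  have hB : Function.Injective B := by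
    rw [← LinearMap.ker_eq_bot, LinearMap.ker_eq_bot']
    intro u hu
    exact g.nondegenerate x u fun w => LinearMap.congr_fun hu w
  have hS : Function.Surjective B :=
    (LinearMap.injective_iff_surjective_of_finrank_eq_finrank
      Subspace.dual_finrank_eq.symm).1 hB
  obtain ⟨u, hu⟩ := hS (φ : TangentSpace I x →ₗ[ℝ] ℝ)
  refine ⟨u, fun v => LinearMap.congr_fun hu v, fun u' hu' => hB ?_⟩
  rw [hu]
  ext v
  exact hu' v

/-- The tangent vector metrically dual to the covector `φ`. -/
def SemiRiemannianMetric.sharp (g : SemiRiemannianMetric I M) (x : M)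
    (φ : TangentSpace I x →L[ℝ] ℝ) : TangentSpace I x :=
  (g.existsUnique_sharp x φ).choose

theorem SemiRiemannianMetric.inner_sharp (g : SemiRiemannianMetric I M) (x : M)
    (φ : TangentSpace I x →L[ℝ] ℝ) (v : TangentSpace I x) :
    g.inner x (g.sharp x φ) v = φ v :=
  (g.existsUnique_sharp x φ).choose_spec.1 v

/-- The gradient of a function, `⟨grad h, v⟩ = dh(v)`. -/
def SemiRiemannianMetric.grad (g : SemiRiemannianMetric I M) (h : M → ℝ) (x : M) :
    TangentSpace I x :=
  g.sharp x (mvfderiv I h x)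

/-- `D` is the Levi-Civita connection of the metric `g`: it is torsion-free and
`u⟨Y, Z⟩ = ⟨D_u Y, Z⟩ + ⟨Y, D_u Z⟩` for every tangent vector `u`.
(`D Y x u` is `D_u Y` at `x`.) -/
def IsLeviCivita (g : ∀ x : M, TangentSpace I x →L[ℝ] TangentSpace I x →L[ℝ] ℝ)
    (D : CovariantDerivative I E (TangentSpace I : M → Type _)) : Prop :=
  D.torsion = 0 ∧
    ∀ (x : M) (Y Z : ∀ y : M, TangentSpace I y),
      MDifferentiableAt I I.tangent (fun y => (⟨y, Y y⟩ : TangentBundle I M)) x →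
      MDifferentiableAt I I.tangent (fun y => (⟨y, Z y⟩ : TangentBundle I M)) x →
      ∀ u : TangentSpace I x,
        mvfderiv I (fun y => g y (Y y) (Z y)) x u =
          g x (D Y x u) (Z x) + g x (Y x) (D Z x u)

end Metric

/-! ### Isometric immersions -/

section Immersion

variable {E : Type*} [NormedAddCommGroup E] [NormedSpace ℝ E] [FiniteDimensional ℝ E]
  {H : Type*} [TopologicalSpace H] {I : ModelWithCorners ℝ E H}
  {M : Type*} [TopologicalSpace M] [ChartedSpace H M] [IsManifold I ∞ M]
  {F : Type*} [NormedAddCommGroup F] [NormedSpace ℝ F] [FiniteDimensional ℝ F]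
  {G : Type*} [TopologicalSpace G] {J : ModelWithCorners ℝ F G}
  {P : Type*} [TopologicalSpace P] [ChartedSpace G P] [IsManifold J ∞ P]

/-- `f` is an isometric immersion: it is smooth and `⟨df u, df v⟩ = ⟨u, v⟩`. (Since the metric of
`M` is nondegenerate, this forces every differential of `f` to be injective.) -/
def IsIsometricImmersion (g : SemiRiemannianMetric I M)
    (gP : ∀ p : P, TangentSpace J p →L[ℝ] TangentSpace J p →L[ℝ] ℝ) (f : M → P) : Prop :=
  ContMDiff I J ∞ f ∧
    ∀ (x : M) (u v : TangentSpace I x),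
      gP (f x) (mfderiv I J f x u) (mfderiv I J f x v) = g.inner x u v

/-- The covariant derivative along `f` induced by a connection `D` of `P`: for a section `W` of
`TP` along `f` it is `D_u W` at `x`. In the trivialization of `TP` at `f x`, the section `W` has
a component function `w : M → F`; the constant component `w x` defines a local vector field `S`
of `P`, and `D_u W = dw(u) + D_{df u} S`. -/
def derivAlong (D : CovariantDerivative J F (TangentSpace J : P → Type _)) (f : M → P)
    (W : ∀ y : M, TangentSpace J (f y)) (x : M) (u : TangentSpace I x) :
    TangentSpace J (f x) :=
  (trivializationAt F (TangentSpace J : P → Type _) (f x)).symm (f x)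
      (mvfderiv I (fun y =>
        (trivializationAt F (TangentSpace J : P → Type _) (f x)
          (⟨f y, W y⟩ : TangentBundle J P)).2) x u) +
    D (FiberBundle.extend F (W x)) (f x) (mfderiv I J f x u)

variable (g : SemiRiemannianMetric I M)
  (gP : ∀ p : P, TangentSpace J p →L[ℝ] TangentSpace J p →L[ℝ] ℝ)
  (D : CovariantDerivative J F (TangentSpace J : P → Type _)) (f : M → P)

/-- The component of `w ∈ T_{f x}P` tangent to `M`: the vector `u ∈ T_xM` with
`⟨u, v⟩ = ⟨w, df v⟩` for all `v ∈ T_xM`. -/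
def tangentPart (x : M) (w : TangentSpace J (f x)) : TangentSpace I x :=
  g.sharp x ((gP (f x) w).comp (mfderiv I J f x))

/-- The component of `w ∈ T_{f x}P` normal to `M`. -/
def normalPart (x : M) (w : TangentSpace J (f x)) : TangentSpace J (f x) :=
  w - mfderiv I J f x (tangentPart g gP f x w)

/-- `w ∈ T_{f x}P` is normal to `M`. -/
def IsNormal (x : M) (w : TangentSpace J (f x)) : Prop :=
  ∀ v : TangentSpace I x, gP (f x) w (mfderiv I J f x v) = 0

/-- The second fundamental form `α(u, v)`: the normal component of the derivative along `f`, in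
the direction `u`, of `df V`, where `V` is a local vector field on `M` with `V x = v`. -/
def secondFundamentalForm (x : M) (u v : TangentSpace I x) : TangentSpace J (f x) :=
  normalPart g gP f x
    (derivAlong D f (fun y => mfderiv I J f y (FiberBundle.extend E v y)) x u)

/-- The normal connection `∇^⊥_u η`. -/
def normalConnection (η : ∀ y : M, TangentSpace J (f y)) (x : M) (u : TangentSpace I x) :
    TangentSpace J (f x) :=
  normalPart g gP f x (derivAlong D f η x u)

/-- The covariant derivative of the second fundamental form, seen as the trilinear form
`(X, Z, η) ↦ ⟨α(X, Z), η⟩`: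
`(∇_Y α)(X, Z, η) = Y⟨α(X, Z), η⟩ - ⟨α(∇_Y X, Z), η⟩ - ⟨α(X, ∇_Y Z), η⟩ - ⟨α(X, Z), ∇^⊥_Y η⟩`,
where `∇` is the connection `DM` of `M`. -/
def covDerivSecondFundamentalForm
    (DM : CovariantDerivative I E (TangentSpace I : M → Type _))
    (Y X Z : ∀ y : M, TangentSpace I y) (η : ∀ y : M, TangentSpace J (f y)) (x : M) : ℝ :=
  mvfderiv I (fun y => gP (f y) (secondFundamentalForm g gP D f y (X y) (Z y)) (η y)) x (Y x) -
    gP (f x) (secondFundamentalForm g gP D f x (DM X x (Y x)) (Z x)) (η x) -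
    gP (f x) (secondFundamentalForm g gP D f x (X x) (DM Z x (Y x))) (η x) -
    gP (f x) (secondFundamentalForm g gP D f x (X x) (Z x))
      (normalConnection g gP D f η x (Y x))

end Immersion

/-! ### Submanifolds of a warped product: the vector fields `T` and `ξ` -/

section Vertical

variable {E : Type*} [NormedAddCommGroup E] [NormedSpace ℝ E] [FiniteDimensional ℝ E]
  {H : Type*} [TopologicalSpace H] {I : ModelWithCorners ℝ E H}
  {M : Type*} [TopologicalSpace M] [ChartedSpace H M] [IsManifold I ∞ M]
  {F : Type*} [NormedAddCommGroup F] [NormedSpace ℝ F]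
  {G : Type*} [TopologicalSpace G] (K : ModelWithCorners ℝ F G)
  {P : Type*} [TopologicalSpace P] [ChartedSpace G P]
  {J : TopologicalSpace.Opens ℝ}

/-- The tangent vector field `T = ε grad π`, where `π : M → J` is the first component of the
immersion `f : M → J × P`. -/
def tangentT (ε : ℤˣ) (g : SemiRiemannianMetric I M) (f : M → J × P) (x : M) :
    TangentSpace I x :=
  ((ε : ℤ) : ℝ) • g.grad (fun y => ((f y).1 : ℝ)) x

/-- The vector field `ξ = ∂t - T` along the immersion. -/
def normalXi (ε : ℤˣ) (g : SemiRiemannianMetric I M) (f : M → J × P) (x : M) :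
    TangentSpace (𝓘(ℝ, ℝ).prod K) (f x) :=
  partialT K J (f x) - mfderiv I (𝓘(ℝ, ℝ).prod K) f x (tangentT ε g f x)

end Vertical

end WarpedCodazzi

end

open WarpedCodazzi

/-!
The warped product sits in `ℝ × ℝ^{N+1}` as `{(t, p) : g₀(p, p) = c}`. On this vector space the
form `ε dt² + a(t)² g₀` and an explicit symmetric field of Christoffel symbols are defined near the
warped product; the symbols are compatible with the form on tangent vectors and the resulting
connection `d + Γ` preserves tangency, so it computes the Levi-Civita connection of the warped
product. Everything on `M` is then pulled back by the composite map `Φ : M → ℝ × ℝ^{N+1}`: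
covariant derivatives become `dW + Γ(dΦ, W)`, the Codazzi equation becomes the commutation formula
for second derivatives of `Φ`, and the curvature that appears there is a polynomial in `Γ` and its
first derivative.
-/

noncomputable section

namespace WarpedCodazzi

open VectorField

section Calculus

variable {E : Type*} [NormedAddCommGroup E] [NormedSpace ℝ E]
  {H : Type*} [TopologicalSpace H] {I : ModelWithCorners ℝ E H}
  {M : Type*} [TopologicalSpace M] [ChartedSpace H M]
  {F : Type*} [NormedAddCommGroup F] [NormedSpace ℝ F]
  {F' : Type*} [NormedAddCommGroup F'] [NormedSpace ℝ F']
  {x : M}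

theorem mvfderiv_congr_of_eventuallyEq {h k : M → F} (hk : h =ᶠ[𝓝 x] k) :
    mvfderiv I h x = mvfderiv I k x := by
  ext u
  exact DFunLike.congr_fun (hk.mfderiv_eq (I := I) (I' := 𝓘(ℝ, F))) u

theorem mvfderiv_fun_comp_apply {E' : Type*} [NormedAddCommGroup E'] [NormedSpace ℝ E']
    {H' : Type*} [TopologicalSpace H'] {I' : ModelWithCorners ℝ E' H'}
    {M' : Type*} [TopologicalSpace M'] [ChartedSpace H' M'] {h : M' → F} {f : M → M'}
    (hh : MDifferentiableAt I' 𝓘(ℝ, F) h (f x)) (hf : MDifferentiableAt I I' f x)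
    (u : TangentSpace I x) :
    mvfderiv I (fun y => h (f y)) x u = mvfderiv I' h (f x) (mfderiv I I' f x u) :=
  mfderiv_comp_apply x hh hf u

theorem mvfderiv_fderiv_comp_apply {φ : F → F'} {h : M → F} (hφ : DifferentiableAt ℝ φ (h x))
    (hh : MDifferentiableAt I 𝓘(ℝ, F) h x) (u : TangentSpace I x) :
    mvfderiv I (fun y => φ (h y)) x u = fderiv ℝ φ (h x) (mvfderiv I h x u) := by
  rw [mvfderiv_fun_comp_apply hφ.mdifferentiableAt hh, mvfderiv, mfderiv_eq_fderiv]
  rfl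

theorem mvfderiv_clm_apply {A : M → F →L[ℝ] F'} {k : M → F}
    (hA : MDifferentiableAt I 𝓘(ℝ, F →L[ℝ] F') A x) (hk : MDifferentiableAt I 𝓘(ℝ, F) k x)
    (u : TangentSpace I x) :
    mvfderiv I (fun y => A y (k y)) x u = mvfderiv I A x u (k x) + A x (mvfderiv I k x u) := by
  have hpair : HasMFDerivAt I 𝓘(ℝ, (F →L[ℝ] F') × F) (fun y => (A y, k y)) x
      ((mvfderiv I A x).prod (mvfderiv I k x)) :=
    ⟨hA.continuousAt.prodMk hk.continuousAt, hA.hasMFDerivAt.2.prodMk hk.hasMFDerivAt.2⟩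
  have happly := (isBoundedBilinearMap_apply (𝕜 := ℝ) (E := F) (F := F')).hasFDerivAt (A x, k x)
  have hcomp := DFunLike.congr_fun (happly.hasMFDerivAt.comp x hpair).mfderiv u
  refine hcomp.trans ?_
  exact add_comm _ _

end Calculus

section Trivialization

variable {E : Type*} [NormedAddCommGroup E] [NormedSpace ℝ E]
  {H : Type*} [TopologicalSpace H] {I : ModelWithCorners ℝ E H}
  {M : Type*} [TopologicalSpace M] [ChartedSpace H M]
  {F : Type*} [NormedAddCommGroup F] [NormedSpace ℝ F]
  {G : Type*} [TopologicalSpace G] {J : ModelWithCorners ℝ F G}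
  {P : Type*} [TopologicalSpace P] [ChartedSpace G P] [IsManifold J 1 P]
  {V : Type*} [NormedAddCommGroup V] [NormedSpace ℝ V] {x : M}

variable (J) in
/-- The differential of `ι : P → V` read in the trivialization of `TP` at `p`. -/
def derivInCoordinates (ι : P → V) (p q : P) : F →L[ℝ] V :=
  (mvfderiv J ι q).comp ((trivializationAt F (TangentSpace J : P → Type _) p).symmL ℝ q)

theorem derivInCoordinates_trivializationAt {ι : P → V} {p q : P}
    (hq : q ∈ (trivializationAt F (TangentSpace J : P → Type _) p).baseSet)
    (w : TangentSpace J q) :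
    derivInCoordinates J ι p q
      (trivializationAt F (TangentSpace J : P → Type _) p (⟨q, w⟩ : TangentBundle J P)).2 =
      mvfderiv J ι q w := by
  rw [derivInCoordinates, ContinuousLinearMap.comp_apply, Bundle.Trivialization.symmL_apply,
    Bundle.Trivialization.symm_apply_apply_mk _ hq]
  exact hq

theorem contMDiffAt_derivInCoordinates {m n : ℕ∞ω} {ι : P → V} {p : P} (hmn : m + 1 ≤ n)
    (hι : ContMDiffAt J 𝓘(ℝ, V) n ι p) :
    ContMDiffAt J 𝓘(ℝ, F →L[ℝ] V) m (derivInCoordinates J ι p) p := by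
  refine (hι.mfderiv_const hmn).congr_of_eventuallyEq
    (.of_forall fun q => ContinuousLinearMap.ext fun v => ?_)
  simp only [inTangentCoordinates, ContinuousLinearMap.inCoordinates, derivInCoordinates]
  simp only [ContinuousLinearMap.comp_apply, TangentBundle.continuousLinearMapAt_model_space,
    id_eq]
  rfl

theorem mdifferentiableAt_derivInCoordinates {ι : P → V} {p : P}
    (hι : ContMDiffAt J 𝓘(ℝ, V) 2 ι p) :
    MDifferentiableAt J 𝓘(ℝ, F →L[ℝ] V) (derivInCoordinates J ι p) p :=
  (contMDiffAt_derivInCoordinates (m := 1) (by norm_num) hι).mdifferentiableAt one_ne_zero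

variable {ι : P → V} {f : M → P} {W : ∀ y : M, TangentSpace J (f y)}

theorem mvfderiv_apply_eventuallyEq (hf : ContinuousAt f x) :
    (fun y => mvfderiv J ι (f y) (W y)) =ᶠ[𝓝 x] fun y =>
      derivInCoordinates J ι (f x) (f y) (trivializationAt F (TangentSpace J : P → Type _) (f x)
        (⟨f y, W y⟩ : TangentBundle J P)).2 := by
  filter_upwards [hf.eventually <| (trivializationAt F (TangentSpace J : P → Type _)
    (f x)).open_baseSet.mem_nhds (FiberBundle.mem_baseSet_trivializationAt' (f x))] with y hy
  exact (derivInCoordinates_trivializationAt hy (W y)).symm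

theorem mdifferentiableAt_mvfderiv_apply (hι : ContMDiffAt J 𝓘(ℝ, V) 2 ι (f x))
    (hf : MDifferentiableAt I J f x)
    (hW : MDifferentiableAt I J.tangent (fun y => (⟨f y, W y⟩ : TangentBundle J P)) x) :
    MDifferentiableAt I 𝓘(ℝ, V) (fun y => mvfderiv J ι (f y) (W y)) x :=
  (((mdifferentiableAt_derivInCoordinates hι).comp x hf).clm_apply
    ((mdifferentiableAt_totalSpace J _).1 hW).2).congr_of_eventuallyEq
    (mvfderiv_apply_eventuallyEq hf.continuousAt)

theorem contMDiffAt_mvfderiv_apply {m n : ℕ∞ω} (hmn : m + 1 ≤ n)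
    (hι : ContMDiffAt J 𝓘(ℝ, V) n ι (f x)) (hf : ContMDiffAt I J m f x)
    (hW : ContMDiffAt I J.tangent m (fun y => (⟨f y, W y⟩ : TangentBundle J P)) x) :
    ContMDiffAt I 𝓘(ℝ, V) m (fun y => mvfderiv J ι (f y) (W y)) x :=
  (((contMDiffAt_derivInCoordinates hmn hι).comp x hf).clm_apply
    (Bundle.contMDiffAt_totalSpace.1 hW).2).congr_of_eventuallyEq
    (mvfderiv_apply_eventuallyEq hf.continuousAt)

theorem mvfderiv_mvfderiv_apply (hι : ContMDiffAt J 𝓘(ℝ, V) 2 ι (f x))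
    (hf : MDifferentiableAt I J f x)
    (hW : MDifferentiableAt I J.tangent (fun y => (⟨f y, W y⟩ : TangentBundle J P)) x)
    (u : TangentSpace I x) :
    mvfderiv I (fun y => mvfderiv J ι (f y) (W y)) x u =
      mvfderiv J (derivInCoordinates J ι (f x)) (f x) (mfderiv I J f x u)
          (trivializationAt F (TangentSpace J : P → Type _) (f x)
            (⟨f x, W x⟩ : TangentBundle J P)).2 +
        derivInCoordinates J ι (f x) (f x)
          (mvfderiv I (fun y => (trivializationAt F (TangentSpace J : P → Type _) (f x)
            (⟨f y, W y⟩ : TangentBundle J P)).2) x u) := by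
  have hA := mdifferentiableAt_derivInCoordinates hι
  have hAf : MDifferentiableAt I 𝓘(ℝ, F →L[ℝ] V)
    (fun y => derivInCoordinates J ι (f x) (f y)) x := hA.comp x hf
  rw [mvfderiv_congr_of_eventuallyEq (mvfderiv_apply_eventuallyEq hf.continuousAt),
    mvfderiv_clm_apply hAf ((mdifferentiableAt_totalSpace J _).1 hW).2,
    mvfderiv_fun_comp_apply hA hf]

theorem mvfderiv_trivializationAt_extend {p : P} (w : TangentSpace J p) :
    mvfderiv J (fun q => (trivializationAt F (TangentSpace J : P → Type _) p
      (⟨q, FiberBundle.extend F w q⟩ : TangentBundle J P)).2) p = 0 := by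
  have hp := FiberBundle.mem_baseSet_trivializationAt' (F := F)
    (E := (TangentSpace J : P → Type _)) p
  have hconst : (fun q => (trivializationAt F (TangentSpace J : P → Type _) p
      (⟨q, FiberBundle.extend F w q⟩ : TangentBundle J P)).2) =ᶠ[𝓝 p] fun _ =>
      (trivializationAt F (TangentSpace J : P → Type _) p (⟨p, w⟩ : TangentBundle J P)).2 := by
    filter_upwards [(trivializationAt F (TangentSpace J : P → Type _) p).open_baseSet.mem_nhds hp]
      with q hq
    rw [FiberBundle.extend, Bundle.Trivialization.apply_mk_symm _ hq]
  rw [mvfderiv_congr_of_eventuallyEq hconst, mvfderiv_const]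

theorem mvfderiv_mvfderiv_apply_eq_extend (hι : ContMDiffAt J 𝓘(ℝ, V) 2 ι (f x))
    (hf : MDifferentiableAt I J f x)
    (hW : MDifferentiableAt I J.tangent (fun y => (⟨f y, W y⟩ : TangentBundle J P)) x)
    (u : TangentSpace I x) :
    mvfderiv I (fun y => mvfderiv J ι (f y) (W y)) x u =
      mvfderiv J ι (f x) ((trivializationAt F (TangentSpace J : P → Type _) (f x)).symm (f x)
          (mvfderiv I (fun y => (trivializationAt F (TangentSpace J : P → Type _) (f x)
            (⟨f y, W y⟩ : TangentBundle J P)).2) x u)) +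
        mvfderiv J (fun q => mvfderiv J ι q (FiberBundle.extend F (W x) q)) (f x)
          (mfderiv I J f x u) := by
  have hextend := mvfderiv_mvfderiv_apply (f := fun q : P => q) hι mdifferentiableAt_id
    (FiberBundle.mdifferentiableAt_extend J F (W x)) (mfderiv I J f x u)
  have hid : mfderiv J J (fun q : P => q) (f x) (mfderiv I J f x u) = mfderiv I J f x u :=
    DFunLike.congr_fun mfderiv_id _
  rw [mvfderiv_trivializationAt_extend, hid, FiberBundle.extend_apply_self, zero_apply, map_zero,
    add_zero] at hextend
  rw [mvfderiv_mvfderiv_apply hι hf hW, hextend, add_comm]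
  congr 1
  rw [derivInCoordinates, ContinuousLinearMap.comp_apply, Bundle.Trivialization.symmL_apply]
  exact FiberBundle.mem_baseSet_trivializationAt' (f x)

end Trivialization

section Bracket

variable {E : Type*} [NormedAddCommGroup E] [NormedSpace ℝ E]
  {H : Type*} [TopologicalSpace H] {I : ModelWithCorners ℝ E H}
  {M : Type*} [TopologicalSpace M] [ChartedSpace H M]
  {F : Type*} [NormedAddCommGroup F] [NormedSpace ℝ F]

theorem mvfderiv_comp_extChartAt [IsManifold I 1 M] {x y : M} {k : E → F}
    (hy : y ∈ (chartAt H x).source)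
    (hk : DifferentiableWithinAt ℝ k (range I) (extChartAt I x y)) (u : TangentSpace I y) :
    mvfderiv I (fun z => k (extChartAt I x z)) y u =
      fderivWithin ℝ k (range I) (extChartAt I x y) (mvfderiv I (extChartAt I x) y u) := by
  have hcomp := HasMFDerivWithinAt.comp y hk.hasFDerivWithinAt.hasMFDerivWithinAt
    (mdifferentiableAt_extChartAt hy).hasMFDerivAt.hasMFDerivWithinAt
    (fun _ _ => mem_range_self _ : univ ⊆ extChartAt I x ⁻¹' range I)
  exact DFunLike.congr_fun (hasMFDerivWithinAt_univ.1 hcomp).mfderiv u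

theorem mvfderiv_eq_fderivWithin [IsManifold I 1 M] {x y : M} {h : M → F}
    (hy : y ∈ (chartAt H x).source) (hh : MDifferentiableAt I 𝓘(ℝ, F) h y)
    (u : TangentSpace I y) :
    mvfderiv I h y u = fderivWithin ℝ (h ∘ (extChartAt I x).symm) (range I) (extChartAt I x y)
      (mvfderiv I (extChartAt I x) y u) := by
  have hk : DifferentiableWithinAt ℝ (h ∘ (extChartAt I x).symm) (range I) (extChartAt I x y) :=
    ((mdifferentiableAt_iff_of_mem_source hy (mem_chart_source F (h y))).1 hh).2
  rw [← mvfderiv_comp_extChartAt hy hk]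
  refine DFunLike.congr_fun (mvfderiv_congr_of_eventuallyEq ?_) u
  filter_upwards [(chartAt H x).open_source.mem_nhds hy] with z hz
  rw [Function.comp_apply, (extChartAt I x).left_inv (by rwa [extChartAt_source])]

variable [IsManifold I 2 M] {x : M} {U V : ∀ y : M, TangentSpace I y}

variable (I) in
/-- The vector field `U` read in the preferred chart at `x`. -/
def chartField (x : M) (U : ∀ y : M, TangentSpace I y) : E → E :=
  mpullbackWithin 𝓘(ℝ, E) I (extChartAt I x).symm U (range I)

omit [IsManifold I 2 M] in
theorem chartField_eq [IsManifold I 1 M] {z : E} (hz : z ∈ (extChartAt I x).target) :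
    chartField I x U z =
      mvfderiv I (extChartAt I x) ((extChartAt I x).symm z) (U ((extChartAt I x).symm z)) := by
  have hinv := isInvertible_mfderivWithin_extChartAt_symm (I := I) hz
  have hcomp := DFunLike.congr_fun (mfderiv_extChartAt_comp_mfderivWithin_extChartAt_symm hz)
    (chartField I x U z)
  rw [← hinv.self_apply_inverse (U ((extChartAt I x).symm z))]
  exact hcomp.symm

omit [IsManifold I 2 M] in
theorem chartField_extChartAt [IsManifold I 1 M] {y : M} (hy : y ∈ (chartAt H x).source) :
    chartField I x U (extChartAt I x y) = mvfderiv I (extChartAt I x) y (U y) := by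
  rw [← extChartAt_source I] at hy
  rw [chartField_eq ((extChartAt I x).map_source hy), (extChartAt I x).left_inv hy]

theorem differentiableWithinAt_chartField [CompleteSpace E]
    (hU : MDifferentiableAt I I.tangent (fun y => (⟨y, U y⟩ : TangentBundle I M)) x) :
    DifferentiableWithinAt ℝ (chartField I x U) (range I) (extChartAt I x x) := by
  have h : DifferentiableWithinAt ℝ (chartField I x U)
      ((extChartAt I x).symm ⁻¹' univ ∩ range I) (extChartAt I x x) :=
    MDifferentiableWithinAt.differentiableWithinAt_mpullbackWithin_vectorField
      (mdifferentiableWithinAt_univ.2 hU)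
  rwa [preimage_univ, univ_inter] at h

omit [IsManifold I 2 M] in
theorem mvfderiv_extChartAt_mlieBracket [IsManifold I 1 M] :
    mvfderiv I (extChartAt I x) x (mlieBracket I U V x) =
      lieBracketWithin ℝ (chartField I x U) (chartField I x V) (range I) (extChartAt I x x) := by
  rw [← mlieBracketWithin_univ, mlieBracketWithin_apply, preimage_univ, univ_inter]
  exact (isInvertible_mfderiv_extChartAt (mem_extChartAt_source x)).self_apply_inverse _

theorem mvfderiv_mvfderiv_apply_eq_fderivWithin [CompleteSpace E] {h : M → F}
    (hh : ContMDiffAt I 𝓘(ℝ, F) 2 h x)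
    (hV : MDifferentiableAt I I.tangent (fun y => (⟨y, V y⟩ : TangentBundle I M)) x)
    (u : TangentSpace I x) :
    mvfderiv I (fun y => mvfderiv I h y (V y)) x u =
      fderivWithin ℝ (fun z => fderivWithin ℝ (h ∘ (extChartAt I x).symm) (range I) z
        (chartField I x V z)) (range I) (extChartAt I x x) (mvfderiv I (extChartAt I x) x u) := by
  have hchart : (fun y => mvfderiv I h y (V y)) =ᶠ[𝓝 x] fun y =>
      fderivWithin ℝ (h ∘ (extChartAt I x).symm) (range I) (extChartAt I x y)
        (chartField I x V (extChartAt I x y)) := by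
    filter_upwards [chart_source_mem_nhds H x,
      (contMDiffAt_iff_contMDiffAt_nhds (by simp)).1 hh] with y hy hhy
    rw [chartField_extChartAt hy, mvfderiv_eq_fderivWithin hy (hhy.mdifferentiableAt two_ne_zero)]
  have hderiv : DifferentiableWithinAt ℝ
      (fderivWithin ℝ (h ∘ (extChartAt I x).symm) (range I)) (range I) (extChartAt I x x) :=
    ((contMDiffAt_iff.1 hh).2.fderivWithin_right (m := 1) I.uniqueDiffOn (by norm_num)
      (mem_range_self _)).differentiableWithinAt one_ne_zero
  rw [mvfderiv_congr_of_eventuallyEq hchart, mvfderiv_comp_extChartAt (mem_chart_source H x)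
    (hderiv.clm_apply (differentiableWithinAt_chartField hV))]

theorem mvfderiv_mvfderiv_apply_sub [CompleteSpace E] {h : M → F}
    (hh : ContMDiffAt I 𝓘(ℝ, F) 2 h x)
    (hU : MDifferentiableAt I I.tangent (fun y => (⟨y, U y⟩ : TangentBundle I M)) x)
    (hV : MDifferentiableAt I I.tangent (fun y => (⟨y, V y⟩ : TangentBundle I M)) x) :
    mvfderiv I (fun y => mvfderiv I h y (V y)) x (U x) -
        mvfderiv I (fun y => mvfderiv I h y (U y)) x (V x) =
      mvfderiv I h x (mlieBracket I U V x) := by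
  have hx := mem_chart_source H x
  rw [mvfderiv_mvfderiv_apply_eq_fderivWithin hh hV, mvfderiv_mvfderiv_apply_eq_fderivWithin hh hU,
    mvfderiv_eq_fderivWithin hx (hh.mdifferentiableAt two_ne_zero),
    mvfderiv_extChartAt_mlieBracket, ← chartField_extChartAt hx, ← chartField_extChartAt hx]
  exact (fderivWithin_apply_lieBracket (contMDiffAt_iff.1 hh).2 (by simp) I.uniqueDiffOn
    (I.range_subset_closure_interior (mem_range_self _)) (mem_range_self _)
    (differentiableWithinAt_chartField hV) (differentiableWithinAt_chartField hU)).symm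

end Bracket

section CovDerivAlong

variable {E : Type*} [NormedAddCommGroup E] [NormedSpace ℝ E]
  {H : Type*} [TopologicalSpace H] {I : ModelWithCorners ℝ E H}
  {M : Type*} [TopologicalSpace M] [ChartedSpace H M]
  {V : Type*} [NormedAddCommGroup V] [NormedSpace ℝ V]
  {Γ : V → V →L[ℝ] V →L[ℝ] V} {Φ W : M → V} {x : M}

variable (I) in
/-- The covariant derivative `D_u W = dW(u) + Γ(dΦ(u), W)` of a vector field `W` along `Φ : M → V`,
where `V` is a vector space with the connection `d + Γ`. -/
def covDerivAlong (Γ : V → V →L[ℝ] V →L[ℝ] V) (Φ W : M → V) (x : M) : TangentSpace I x →L[ℝ] V :=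
  mvfderiv I W x + ((Γ (Φ x)).flip (W x)).comp (mvfderiv I Φ x)

theorem covDerivAlong_apply (u : TangentSpace I x) :
    covDerivAlong I Γ Φ W x u = mvfderiv I W x u + Γ (Φ x) (mvfderiv I Φ x u) (W x) :=
  rfl

/-- The curvature `R(u, v)w` of the connection `d + Γ` of the vector space `V`. -/
def christoffelCurvature (Γ : V → V →L[ℝ] V →L[ℝ] V) (q u v w : V) : V :=
  fderiv ℝ Γ q u v w - fderiv ℝ Γ q v u w + (Γ q u (Γ q v w) - Γ q v (Γ q u w))

variable [IsManifold I 2 M] {X Y : ∀ y : M, TangentSpace I y}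

theorem mdifferentiableAt_christoffel (hΓ : DifferentiableAt ℝ Γ (Φ x))
    (hΦ : ContMDiffAt I 𝓘(ℝ, V) 2 Φ x)
    (hX : MDifferentiableAt I I.tangent (fun y => (⟨y, X y⟩ : TangentBundle I M)) x) :
    MDifferentiableAt I 𝓘(ℝ, V →L[ℝ] V) (fun y => Γ (Φ y) (mvfderiv I Φ y (X y))) x :=
  (hΓ.mdifferentiableAt.comp x (hΦ.mdifferentiableAt two_ne_zero)).clm_apply
    (mdifferentiableAt_mvfderiv_apply hΦ mdifferentiableAt_id hX)

theorem mdifferentiableAt_covDerivAlong (hΓ : DifferentiableAt ℝ Γ (Φ x))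
    (hΦ : ContMDiffAt I 𝓘(ℝ, V) 2 Φ x) (hW : ContMDiffAt I 𝓘(ℝ, V) 2 W x)
    (hX : MDifferentiableAt I I.tangent (fun y => (⟨y, X y⟩ : TangentBundle I M)) x) :
    MDifferentiableAt I 𝓘(ℝ, V) (fun y => covDerivAlong I Γ Φ W y (X y)) x :=
  (mdifferentiableAt_mvfderiv_apply hW mdifferentiableAt_id hX).add
    ((mdifferentiableAt_christoffel hΓ hΦ hX).clm_apply (hW.mdifferentiableAt two_ne_zero))

theorem covDerivAlong_covDerivAlong (hΓ : DifferentiableAt ℝ Γ (Φ x))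
    (hΦ : ContMDiffAt I 𝓘(ℝ, V) 2 Φ x) (hW : ContMDiffAt I 𝓘(ℝ, V) 2 W x)
    (hX : MDifferentiableAt I I.tangent (fun y => (⟨y, X y⟩ : TangentBundle I M)) x)
    (u : TangentSpace I x) :
    covDerivAlong I Γ Φ (fun y => covDerivAlong I Γ Φ W y (X y)) x u =
      mvfderiv I (fun y => mvfderiv I W y (X y)) x u +
        (fderiv ℝ Γ (Φ x) (mvfderiv I Φ x u) (mvfderiv I Φ x (X x)) (W x) +
          Γ (Φ x) (mvfderiv I (fun y => mvfderiv I Φ y (X y)) x u) (W x) +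
          Γ (Φ x) (mvfderiv I Φ x (X x)) (mvfderiv I W x u)) +
        Γ (Φ x) (mvfderiv I Φ x u) (covDerivAlong I Γ Φ W x (X x)) := by
  have hΦ' := hΦ.mdifferentiableAt two_ne_zero
  have hW' := hW.mdifferentiableAt two_ne_zero
  have hΦX : MDifferentiableAt I 𝓘(ℝ, V) (fun y => mvfderiv I Φ y (X y)) x :=
    mdifferentiableAt_mvfderiv_apply hΦ mdifferentiableAt_id hX
  have hΓX := mdifferentiableAt_christoffel hΓ hΦ hX
  have hsum : mvfderiv I (fun y => covDerivAlong I Γ Φ W y (X y)) x =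
      mvfderiv I (fun y => mvfderiv I W y (X y)) x +
        mvfderiv I (fun y => Γ (Φ y) (mvfderiv I Φ y (X y)) (W y)) x :=
    mvfderiv_add (mdifferentiableAt_mvfderiv_apply hW mdifferentiableAt_id hX)
      (hΓX.clm_apply hW')
  rw [covDerivAlong_apply, hsum, add_apply, mvfderiv_clm_apply hΓX hW',
    mvfderiv_clm_apply (A := fun y => Γ (Φ y)) (hΓ.mdifferentiableAt.comp x hΦ') hΦX,
    mvfderiv_fderiv_comp_apply hΓ hΦ', add_apply]

theorem covDerivAlong_mvfderiv_sub [CompleteSpace E] (hΦ : ContMDiffAt I 𝓘(ℝ, V) 2 Φ x)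
    (hΓ : ∀ u v, Γ (Φ x) u v = Γ (Φ x) v u)
    (hX : MDifferentiableAt I I.tangent (fun y => (⟨y, X y⟩ : TangentBundle I M)) x)
    (hY : MDifferentiableAt I I.tangent (fun y => (⟨y, Y y⟩ : TangentBundle I M)) x) :
    covDerivAlong I Γ Φ (fun y => mvfderiv I Φ y (Y y)) x (X x) -
        covDerivAlong I Γ Φ (fun y => mvfderiv I Φ y (X y)) x (Y x) =
      mvfderiv I Φ x (mlieBracket I X Y x) := by
  rw [← mvfderiv_mvfderiv_apply_sub hΦ hX hY, covDerivAlong_apply, covDerivAlong_apply, hΓ,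
    add_sub_add_right_eq_sub]

theorem covDerivAlong_covDerivAlong_sub [CompleteSpace E] (hΓ : DifferentiableAt ℝ Γ (Φ x))
    (hΦ : ContMDiffAt I 𝓘(ℝ, V) 2 Φ x) (hW : ContMDiffAt I 𝓘(ℝ, V) 2 W x)
    (hX : MDifferentiableAt I I.tangent (fun y => (⟨y, X y⟩ : TangentBundle I M)) x)
    (hY : MDifferentiableAt I I.tangent (fun y => (⟨y, Y y⟩ : TangentBundle I M)) x) :
    covDerivAlong I Γ Φ (fun y => covDerivAlong I Γ Φ W y (X y)) x (Y x) -
        covDerivAlong I Γ Φ (fun y => covDerivAlong I Γ Φ W y (Y y)) x (X x) =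
      covDerivAlong I Γ Φ W x (mlieBracket I Y X x) +
        christoffelCurvature Γ (Φ x) (mvfderiv I Φ x (Y x)) (mvfderiv I Φ x (X x)) (W x) := by
  rw [covDerivAlong_covDerivAlong hΓ hΦ hW hX, covDerivAlong_covDerivAlong hΓ hΦ hW hY,
    covDerivAlong_apply (mlieBracket I Y X x), ← mvfderiv_mvfderiv_apply_sub hW hY hX,
    ← mvfderiv_mvfderiv_apply_sub hΦ hY hX]
  simp only [covDerivAlong_apply, christoffelCurvature, map_add, map_sub, sub_apply]
  abel

omit [IsManifold I 2 M] in
theorem mvfderiv_form_apply {B : V → V →L[ℝ] V →L[ℝ] ℝ} {W' : M → V}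
    (hB : DifferentiableAt ℝ B (Φ x)) (hΦ : MDifferentiableAt I 𝓘(ℝ, V) Φ x)
    (hW : MDifferentiableAt I 𝓘(ℝ, V) W x) (hW' : MDifferentiableAt I 𝓘(ℝ, V) W' x)
    {u : TangentSpace I x}
    (hcompat : fderiv ℝ B (Φ x) (mvfderiv I Φ x u) (W x) (W' x) =
      B (Φ x) (Γ (Φ x) (mvfderiv I Φ x u) (W x)) (W' x) +
        B (Φ x) (W x) (Γ (Φ x) (mvfderiv I Φ x u) (W' x))) :
    mvfderiv I (fun y => B (Φ y) (W y) (W' y)) x u =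
      B (Φ x) (covDerivAlong I Γ Φ W x u) (W' x) + B (Φ x) (W x) (covDerivAlong I Γ Φ W' x u) := by
  have hBΦ : MDifferentiableAt I 𝓘(ℝ, V →L[ℝ] V →L[ℝ] ℝ) (fun y => B (Φ y)) x :=
    hB.mdifferentiableAt.comp x hΦ
  rw [mvfderiv_clm_apply (hBΦ.clm_apply hW) hW', mvfderiv_clm_apply hBΦ hW,
    mvfderiv_fderiv_comp_apply hB hΦ, add_apply, hcompat]
  simp only [covDerivAlong_apply, map_add, add_apply]
  ring

end CovDerivAlong

section ExtrinsicModel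

variable {E : Type*} [NormedAddCommGroup E] [NormedSpace ℝ E]
  {H : Type*} [TopologicalSpace H] {I : ModelWithCorners ℝ E H}
  {M : Type*} [TopologicalSpace M] [ChartedSpace H M]
  {F : Type*} [NormedAddCommGroup F] [NormedSpace ℝ F]
  {G : Type*} [TopologicalSpace G] {J : ModelWithCorners ℝ F G}
  {P : Type*} [TopologicalSpace P] [ChartedSpace G P]
  {V : Type*} [NormedAddCommGroup V] [NormedSpace ℝ V]
  {g : ∀ x : M, TangentSpace I x →L[ℝ] TangentSpace I x →L[ℝ] ℝ}
  {gP : ∀ p : P, TangentSpace J p →L[ℝ] TangentSpace J p →L[ℝ] ℝ}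
  {B : V → V →L[ℝ] V →L[ℝ] ℝ} {Γ : V → V →L[ℝ] V →L[ℝ] V} {Φ : M → V} {ι : P → V} {f : M → P}

variable (I) in
/-- The map `Φ : M → V` into a vector space with the field of forms `B` and the connection `d + Γ`
induces the metric `g`, and along `Φ` the connection is torsion-free and compatible with `B` on
tangent vectors. Away from the image of `Φ`, and on vectors not tangent to it, nothing is required
of `B` and `Γ`; so `d + Γ` need not be a metric connection of `V`. -/
structure IsExtrinsicModel (g : ∀ x : M, TangentSpace I x →L[ℝ] TangentSpace I x →L[ℝ] ℝ)
    (B : V → V →L[ℝ] V →L[ℝ] ℝ) (Γ : V → V →L[ℝ] V →L[ℝ] V) (Φ : M → V) : Prop where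
  contMDiff : ContMDiff I 𝓘(ℝ, V) ∞ Φ
  form_mvfderiv : ∀ (x : M) (v w : TangentSpace I x),
    B (Φ x) (mvfderiv I Φ x v) (mvfderiv I Φ x w) = g x v w
  form_symm : ∀ (x : M) (v w : V), B (Φ x) v w = B (Φ x) w v
  christoffel_symm : ∀ (x : M) (v w : V), Γ (Φ x) v w = Γ (Φ x) w v
  differentiableAt_form : ∀ x : M, DifferentiableAt ℝ B (Φ x)
  differentiableAt_christoffel : ∀ x : M, DifferentiableAt ℝ Γ (Φ x)
  fderiv_form : ∀ (x : M) (u v w : TangentSpace I x),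
    fderiv ℝ B (Φ x) (mvfderiv I Φ x u) (mvfderiv I Φ x v) (mvfderiv I Φ x w) =
      B (Φ x) (Γ (Φ x) (mvfderiv I Φ x u) (mvfderiv I Φ x v)) (mvfderiv I Φ x w) +
        B (Φ x) (mvfderiv I Φ x v) (Γ (Φ x) (mvfderiv I Φ x u) (mvfderiv I Φ x w))

theorem IsExtrinsicModel.comp (h : IsExtrinsicModel J gP B Γ ι) (hf : ContMDiff I J ∞ f)
    (hfg : ∀ (x : M) (u v : TangentSpace I x),
      gP (f x) (mfderiv I J f x u) (mfderiv I J f x v) = g x u v) :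
    IsExtrinsicModel I g B Γ (fun x => ι (f x)) := by
  have hchain (x : M) (u : TangentSpace I x) :
      mvfderiv I (fun y => ι (f y)) x u = mvfderiv J ι (f x) (mfderiv I J f x u) :=
    mvfderiv_fun_comp_apply (h.contMDiff.mdifferentiableAt (by simp))
      (hf.mdifferentiableAt (by simp)) u
  refine ⟨h.contMDiff.comp hf, fun x v w => ?_, fun x => h.form_symm (f x),
    fun x => h.christoffel_symm (f x), fun x => h.differentiableAt_form (f x),
    fun x => h.differentiableAt_christoffel (f x), fun x u v w => ?_⟩
  · rw [hchain, hchain, h.form_mvfderiv, hfg]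
  · rw [hchain, hchain, hchain, h.fderiv_form]

variable [IsManifold I ∞ M]

theorem IsExtrinsicModel.mdifferentiableAt_mvfderiv (h : IsExtrinsicModel I g B Γ Φ) {x : M}
    {X : ∀ y : M, TangentSpace I y}
    (hX : MDifferentiableAt I I.tangent (fun y => (⟨y, X y⟩ : TangentBundle I M)) x) :
    MDifferentiableAt I 𝓘(ℝ, V) (fun y => mvfderiv I Φ y (X y)) x :=
  mdifferentiableAt_mvfderiv_apply ((h.contMDiff x).of_le ENat.LEInfty.out) mdifferentiableAt_id hX

theorem IsExtrinsicModel.contMDiffAt_mvfderiv (h : IsExtrinsicModel I g B Γ Φ) {x : M}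
    {X : ∀ y : M, TangentSpace I y}
    (hX : ContMDiffAt I I.tangent 2 (fun y => (⟨y, X y⟩ : TangentBundle I M)) x) :
    ContMDiffAt I 𝓘(ℝ, V) 2 (fun y => mvfderiv I Φ y (X y)) x :=
  contMDiffAt_mvfderiv_apply (n := 3) (by norm_num) ((h.contMDiff x).of_le ENat.LEInfty.out)
    contMDiffAt_id hX

theorem IsExtrinsicModel.mvfderiv_form_mvfderiv (h : IsExtrinsicModel I g B Γ Φ) {x : M}
    {X Y : ∀ y : M, TangentSpace I y}
    (hX : MDifferentiableAt I I.tangent (fun y => (⟨y, X y⟩ : TangentBundle I M)) x)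
    (hY : MDifferentiableAt I I.tangent (fun y => (⟨y, Y y⟩ : TangentBundle I M)) x)
    (u : TangentSpace I x) :
    mvfderiv I (fun y => g y (X y) (Y y)) x u =
      B (Φ x) (covDerivAlong I Γ Φ (fun y => mvfderiv I Φ y (X y)) x u) (mvfderiv I Φ x (Y x)) +
        B (Φ x) (covDerivAlong I Γ Φ (fun y => mvfderiv I Φ y (Y y)) x u)
          (mvfderiv I Φ x (X x)) := by
  have hprod := mvfderiv_form_apply (h.differentiableAt_form x)
    (h.contMDiff.mdifferentiableAt (by simp)) (h.mdifferentiableAt_mvfderiv hX)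
    (h.mdifferentiableAt_mvfderiv hY) (h.fderiv_form x u (X x) (Y x))
  simp only [h.form_mvfderiv] at hprod
  rw [hprod, h.form_symm x (mvfderiv I Φ x (X x))]

variable (I) in
/-- The difference between the extrinsic and the intrinsic value of `⟨∇_U X, Y⟩`. -/
def connectionDefect (g : ∀ x : M, TangentSpace I x →L[ℝ] TangentSpace I x →L[ℝ] ℝ)
    (B : V → V →L[ℝ] V →L[ℝ] ℝ) (Γ : V → V →L[ℝ] V →L[ℝ] V) (Φ : M → V)
    (D : CovariantDerivative I E (TangentSpace I : M → Type _))
    (U X Y : ∀ y : M, TangentSpace I y) (x : M) : ℝ :=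
  B (Φ x) (covDerivAlong I Γ Φ (fun y => mvfderiv I Φ y (X y)) x (U x)) (mvfderiv I Φ x (Y x)) -
    g x (D X x (U x)) (Y x)

variable [FiniteDimensional ℝ E] {D : CovariantDerivative I E (TangentSpace I : M → Type _)}
  {x : M} {U X Y : ∀ y : M, TangentSpace I y}

theorem IsLeviCivita.sub_eq_mlieBracket (hD : IsLeviCivita g D)
    (hX : MDifferentiableAt I I.tangent (fun y => (⟨y, X y⟩ : TangentBundle I M)) x)
    (hY : MDifferentiableAt I I.tangent (fun y => (⟨y, Y y⟩ : TangentBundle I M)) x) :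
    D Y x (X x) - D X x (Y x) = mlieBracket I X Y x :=
  (CovariantDerivative.torsion_eq_zero_iff D).1 hD.1 hX hY

theorem IsExtrinsicModel.covDerivAlong_sub (h : IsExtrinsicModel I g B Γ Φ)
    (hD : IsLeviCivita g D)
    (hX : MDifferentiableAt I I.tangent (fun y => (⟨y, X y⟩ : TangentBundle I M)) x)
    (hY : MDifferentiableAt I I.tangent (fun y => (⟨y, Y y⟩ : TangentBundle I M)) x) :
    covDerivAlong I Γ Φ (fun y => mvfderiv I Φ y (Y y)) x (X x) -
        covDerivAlong I Γ Φ (fun y => mvfderiv I Φ y (X y)) x (Y x) =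
      mvfderiv I Φ x (D Y x (X x) - D X x (Y x)) := by
  have := FiniteDimensional.complete ℝ E
  rw [covDerivAlong_mvfderiv_sub ((h.contMDiff x).of_le ENat.LEInfty.out) (h.christoffel_symm x)
    hX hY, hD.sub_eq_mlieBracket hX hY]

theorem IsExtrinsicModel.connectionDefect_symm (h : IsExtrinsicModel I g B Γ Φ)
    (hD : IsLeviCivita g D)
    (hU : MDifferentiableAt I I.tangent (fun y => (⟨y, U y⟩ : TangentBundle I M)) x)
    (hX : MDifferentiableAt I I.tangent (fun y => (⟨y, X y⟩ : TangentBundle I M)) x) :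
    connectionDefect I g B Γ Φ D U X Y x = connectionDefect I g B Γ Φ D X U Y x := by
  have hsub := congrArg (fun v => B (Φ x) v (mvfderiv I Φ x (Y x))) (h.covDerivAlong_sub hD hU hX)
  simp only [h.form_mvfderiv, map_sub, sub_apply] at hsub
  unfold connectionDefect
  linarith

theorem IsExtrinsicModel.connectionDefect_antisymm (h : IsExtrinsicModel I g B Γ Φ)
    (hD : IsLeviCivita g D)
    (hX : MDifferentiableAt I I.tangent (fun y => (⟨y, X y⟩ : TangentBundle I M)) x)
    (hY : MDifferentiableAt I I.tangent (fun y => (⟨y, Y y⟩ : TangentBundle I M)) x) :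
    connectionDefect I g B Γ Φ D U X Y x = -connectionDefect I g B Γ Φ D U Y X x := by
  have hmetric := hD.2 x X Y hX hY (U x)
  have hsymm : g x (X x) (D Y x (U x)) = g x (D Y x (U x)) (X x) := by
    rw [← h.form_mvfderiv, h.form_symm, h.form_mvfderiv]
  rw [h.mvfderiv_form_mvfderiv hX hY, hsymm] at hmetric
  unfold connectionDefect
  linarith

theorem IsExtrinsicModel.inner_leviCivita (h : IsExtrinsicModel I g B Γ Φ)
    (hD : IsLeviCivita g D)
    (hX : MDifferentiableAt I I.tangent (fun y => (⟨y, X y⟩ : TangentBundle I M)) x)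
    (u w : TangentSpace I x) :
    g x (D X x u) w =
      B (Φ x) (covDerivAlong I Γ Φ (fun y => mvfderiv I Φ y (X y)) x u) (mvfderiv I Φ x w) := by
  set U : ∀ y : M, TangentSpace I y := FiberBundle.extend E u
  set W : ∀ y : M, TangentSpace I y := FiberBundle.extend E w
  have hU : MDifferentiableAt I I.tangent (fun y => (⟨y, U y⟩ : TangentBundle I M)) x :=
    FiberBundle.mdifferentiableAt_extend I E u
  have hW : MDifferentiableAt I I.tangent (fun y => (⟨y, W y⟩ : TangentBundle I M)) x :=
    FiberBundle.mdifferentiableAt_extend I E w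
  -- The Koszul argument: symmetry in `(U, X)` and antisymmetry in `(X, W)` force `0`.
  have hzero : connectionDefect I g B Γ Φ D U X W x = 0 := by
    linarith [h.connectionDefect_symm (Y := W) hD hU hX,
      h.connectionDefect_antisymm (U := X) hD hU hW,
      h.connectionDefect_symm (Y := U) hD hX hW,
      h.connectionDefect_antisymm (U := W) hD hX hU,
      h.connectionDefect_symm (Y := X) hD hW hU,
      h.connectionDefect_antisymm (U := U) hD hW hX]
  have hUx : U x = u := FiberBundle.extend_apply_self E u
  have hWx : W x = w := FiberBundle.extend_apply_self E w
  rw [connectionDefect, hUx, hWx] at hzero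
  linarith

theorem IsExtrinsicModel.covDerivAlong_sub_comm (h : IsExtrinsicModel I g B Γ Φ)
    (hD : IsLeviCivita g D)
    (hX : MDifferentiableAt I I.tangent (fun y => (⟨y, X y⟩ : TangentBundle I M)) x)
    (hY : MDifferentiableAt I I.tangent (fun y => (⟨y, Y y⟩ : TangentBundle I M)) x) :
    covDerivAlong I Γ Φ (fun y => mvfderiv I Φ y (Y y)) x (X x) - mvfderiv I Φ x (D Y x (X x)) =
      covDerivAlong I Γ Φ (fun y => mvfderiv I Φ y (X y)) x (Y x) -
        mvfderiv I Φ x (D X x (Y x)) := by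
  rw [sub_eq_sub_iff_sub_eq_sub, h.covDerivAlong_sub hD hX hY, map_sub]

theorem IsExtrinsicModel.covDerivAlong_sub_congr (h : IsExtrinsicModel I g B Γ Φ)
    (hD : IsLeviCivita g D)
    (hX : MDifferentiableAt I I.tangent (fun y => (⟨y, X y⟩ : TangentBundle I M)) x)
    (hY : MDifferentiableAt I I.tangent (fun y => (⟨y, Y y⟩ : TangentBundle I M)) x)
    (hXY : X x = Y x) (u : TangentSpace I x) :
    covDerivAlong I Γ Φ (fun y => mvfderiv I Φ y (X y)) x u - mvfderiv I Φ x (D X x u) =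
      covDerivAlong I Γ Φ (fun y => mvfderiv I Φ y (Y y)) x u - mvfderiv I Φ x (D Y x u) := by
  have hU := FiberBundle.mdifferentiableAt_extend I E u
  have hUX := h.covDerivAlong_sub_comm hD hU hX
  have hUY := h.covDerivAlong_sub_comm hD hU hY
  rw [FiberBundle.extend_apply_self] at hUX hUY
  rw [hUX, hUY, hXY]

end ExtrinsicModel

section TangentialModel

variable {E : Type*} [NormedAddCommGroup E] [NormedSpace ℝ E]
  {H : Type*} [TopologicalSpace H] {I : ModelWithCorners ℝ E H}
  {M : Type*} [TopologicalSpace M] [ChartedSpace H M]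
  {F : Type*} [NormedAddCommGroup F] [NormedSpace ℝ F]
  {G : Type*} [TopologicalSpace G] {J : ModelWithCorners ℝ F G}
  {P : Type*} [TopologicalSpace P] [ChartedSpace G P] [IsManifold J ∞ P]
  {V : Type*} [NormedAddCommGroup V] [NormedSpace ℝ V]
  {gP : ∀ p : P, TangentSpace J p →L[ℝ] TangentSpace J p →L[ℝ] ℝ}
  {B : V → V →L[ℝ] V →L[ℝ] ℝ} {Γ : V → V →L[ℝ] V →L[ℝ] V} {ι : P → V}

variable (J) in
/-- An extrinsic model `ι : P → V` of a nondegenerate metric for which `d + Γ` differentiates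
tangent vector fields to tangent vectors; `d + Γ` then restricts to the Levi-Civita connection
of `P`. -/
structure IsTangentialModel (gP : ∀ p : P, TangentSpace J p →L[ℝ] TangentSpace J p →L[ℝ] ℝ)
    (B : V → V →L[ℝ] V →L[ℝ] ℝ) (Γ : V → V →L[ℝ] V →L[ℝ] V) (ι : P → V) : Prop
    extends IsExtrinsicModel J gP B Γ ι where
  nondegenerate : ∀ (p : P) (v : TangentSpace J p), (∀ w, gP p v w = 0) → v = 0
  tangential : ∀ (p : P) (S : ∀ q : P, TangentSpace J q),
    MDifferentiableAt J J.tangent (fun q => (⟨q, S q⟩ : TangentBundle J P)) p →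
    ∀ u : TangentSpace J p,
      covDerivAlong J Γ ι (fun q => mvfderiv J ι q (S q)) p u ∈ range (mvfderiv J ι p)

variable [FiniteDimensional ℝ F] {Dbar : CovariantDerivative J F (TangentSpace J : P → Type _)}

theorem IsTangentialModel.mvfderiv_leviCivita (h : IsTangentialModel J gP B Γ ι)
    (hDbar : IsLeviCivita gP Dbar) {p : P} {S : ∀ q : P, TangentSpace J q}
    (hS : MDifferentiableAt J J.tangent (fun q => (⟨q, S q⟩ : TangentBundle J P)) p)
    (u : TangentSpace J p) :
    mvfderiv J ι p (Dbar S p u) = covDerivAlong J Γ ι (fun q => mvfderiv J ι q (S q)) p u := by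
  obtain ⟨v, hv⟩ := h.tangential p S hS u
  have hDv : Dbar S p u = v := by
    refine sub_eq_zero.1 (h.nondegenerate p _ fun w => ?_)
    rw [map_sub, sub_apply, h.inner_leviCivita hDbar hS, ← hv, h.form_mvfderiv, sub_self]
  rw [hDv, hv]

theorem IsTangentialModel.mvfderiv_derivAlong (h : IsTangentialModel J gP B Γ ι)
    (hDbar : IsLeviCivita gP Dbar) {f : M → P} {x : M} (hf : MDifferentiableAt I J f x)
    {W : ∀ y : M, TangentSpace J (f y)}
    (hW : MDifferentiableAt I J.tangent (fun y => (⟨f y, W y⟩ : TangentBundle J P)) x)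
    (u : TangentSpace I x) :
    mvfderiv J ι (f x) (derivAlong Dbar f W x u) =
      covDerivAlong I Γ (fun y => ι (f y)) (fun y => mvfderiv J ι (f y) (W y)) x u := by
  have hextend := h.mvfderiv_leviCivita hDbar (FiberBundle.mdifferentiableAt_extend J F (W x))
    (mfderiv I J f x u)
  rw [derivAlong, map_add, hextend, covDerivAlong_apply, covDerivAlong_apply,
    mvfderiv_mvfderiv_apply_eq_extend ((h.contMDiff (f x)).of_le ENat.LEInfty.out) hf hW,
    mvfderiv_fun_comp_apply (h.contMDiff.mdifferentiableAt (by simp)) hf,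
    FiberBundle.extend_apply_self, add_assoc]

end TangentialModel

section Immersion

variable {E : Type*} [NormedAddCommGroup E] [NormedSpace ℝ E]
  {H : Type*} [TopologicalSpace H] {I : ModelWithCorners ℝ E H}
  {M : Type*} [TopologicalSpace M] [ChartedSpace H M] [IsManifold I ∞ M]
  {F : Type*} [NormedAddCommGroup F] [NormedSpace ℝ F]
  {G : Type*} [TopologicalSpace G] {J : ModelWithCorners ℝ F G}
  {P : Type*} [TopologicalSpace P] [ChartedSpace G P]
  {g : SemiRiemannianMetric I M} {gP : ∀ p : P, TangentSpace J p →L[ℝ] TangentSpace J p →L[ℝ] ℝ}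
  {f : M → P} {x : M}

theorem inner_tangentPart [FiniteDimensional ℝ E] (w : TangentSpace J (f x))
    (v : TangentSpace I x) :
    g.inner x (tangentPart g gP f x w) v = gP (f x) w (mfderiv I J f x v) :=
  g.inner_sharp x _ v

theorem isNormal_normalPart [FiniteDimensional ℝ E] (hf : IsIsometricImmersion g gP f)
    (w : TangentSpace J (f x)) :
    IsNormal (I := I) gP f x (normalPart g gP f x w) := by
  intro v
  rw [normalPart, map_sub, sub_apply, hf.2, inner_tangentPart, sub_self]

variable {V : Type*} [NormedAddCommGroup V] [NormedSpace ℝ V]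
  {B : V → V →L[ℝ] V →L[ℝ] ℝ} {Γ : V → V →L[ℝ] V →L[ℝ] V} {ι : P → V}

theorem mdifferentiableAt_mfderiv_apply [IsManifold J ∞ P] (hf : ContMDiff I J ∞ f)
    {Z : ∀ y : M, TangentSpace I y}
    (hZ : MDifferentiableAt I I.tangent (fun y => (⟨y, Z y⟩ : TangentBundle I M)) x) :
    MDifferentiableAt I J.tangent
      (fun y => (⟨f y, mfderiv I J f y (Z y)⟩ : TangentBundle J P)) x :=
  ((hf.contMDiff_tangentMap (m := ∞) (by simp)).mdifferentiableAt (by simp)).comp x hZ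

theorem IsExtrinsicModel.comp_immersion (h : IsExtrinsicModel J gP B Γ ι)
    (hf : IsIsometricImmersion g gP f) : IsExtrinsicModel I g.inner B Γ (fun y => ι (f y)) :=
  h.comp hf.1 hf.2

theorem IsExtrinsicModel.mvfderiv_comp_immersion (h : IsExtrinsicModel J gP B Γ ι)
    (hf : IsIsometricImmersion g gP f) (u : TangentSpace I x) :
    mvfderiv I (fun y => ι (f y)) x u = mvfderiv J ι (f x) (mfderiv I J f x u) :=
  mvfderiv_fun_comp_apply (h.contMDiff.mdifferentiableAt (by simp))
    (hf.1.mdifferentiableAt (by simp)) u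

theorem IsExtrinsicModel.form_mvfderiv_normal (h : IsExtrinsicModel J gP B Γ ι)
    (hf : IsIsometricImmersion g gP f) {w : TangentSpace J (f x)}
    (hw : IsNormal (I := I) gP f x w) (v : TangentSpace I x) :
    B (ι (f x)) (mvfderiv I (fun y => ι (f y)) x v) (mvfderiv J ι (f x) w) = 0 := by
  rw [h.mvfderiv_comp_immersion hf, h.form_symm, h.form_mvfderiv, hw v]

theorem IsExtrinsicModel.mvfderiv_form_along (h : IsExtrinsicModel J gP B Γ ι)
    (hf : IsIsometricImmersion g gP f) {W W' : M → V} (hW : MDifferentiableAt I 𝓘(ℝ, V) W x)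
    (hW' : MDifferentiableAt I 𝓘(ℝ, V) W' x) {w w' : TangentSpace J (f x)}
    (hw : mvfderiv J ι (f x) w = W x) (hw' : mvfderiv J ι (f x) w' = W' x)
    (u : TangentSpace I x) :
    mvfderiv I (fun y => B (ι (f y)) (W y) (W' y)) x u =
      B (ι (f x)) (covDerivAlong I Γ (fun y => ι (f y)) W x u) (W' x) +
        B (ι (f x)) (W x) (covDerivAlong I Γ (fun y => ι (f y)) W' x u) := by
  refine mvfderiv_form_apply (Φ := fun y => ι (f y)) (h.differentiableAt_form (f x))
    ((h.comp_immersion hf).contMDiff.mdifferentiableAt (by simp)) hW hW' ?_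
  rw [← hw, ← hw', h.mvfderiv_comp_immersion hf]
  exact h.fderiv_form (f x) _ _ _

variable [IsManifold J ∞ P]

theorem IsExtrinsicModel.mdifferentiableAt_mvfderiv_along (h : IsExtrinsicModel J gP B Γ ι)
    (hf : IsIsometricImmersion g gP f) {W : ∀ y : M, TangentSpace J (f y)}
    (hW : MDifferentiableAt I J.tangent (fun y => (⟨f y, W y⟩ : TangentBundle J P)) x) :
    MDifferentiableAt I 𝓘(ℝ, V) (fun y => mvfderiv J ι (f y) (W y)) x :=
  mdifferentiableAt_mvfderiv_apply ((h.contMDiff (f x)).of_le ENat.LEInfty.out)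
    (hf.1.mdifferentiableAt (by simp)) hW

variable [FiniteDimensional ℝ F]
  {Dbar : CovariantDerivative J F (TangentSpace J : P → Type _)}
  {X Y Z : ∀ y : M, TangentSpace I y} {η : ∀ y : M, TangentSpace J (f y)}
  (h : IsTangentialModel J gP B Γ ι) (hf : IsIsometricImmersion g gP f)
  (hDbar : IsLeviCivita gP Dbar)

include h hf hDbar

theorem mvfderiv_derivAlong_mfderiv
    (hZ : MDifferentiableAt I I.tangent (fun y => (⟨y, Z y⟩ : TangentBundle I M)) x)
    (u : TangentSpace I x) :
    mvfderiv J ι (f x) (derivAlong Dbar f (fun y => mfderiv I J f y (Z y)) x u) =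
      covDerivAlong I Γ (fun y => ι (f y))
        (fun y => mvfderiv I (fun y => ι (f y)) y (Z y)) x u := by
  simp only [h.mvfderiv_comp_immersion hf]
  exact h.mvfderiv_derivAlong hDbar (hf.1.mdifferentiableAt (by simp))
    (mdifferentiableAt_mfderiv_apply hf.1 hZ) u

variable {D : CovariantDerivative I E (TangentSpace I : M → Type _)} [FiniteDimensional ℝ E]
  (hD : IsLeviCivita g.inner D)
include hD

theorem tangentPart_derivAlong_mfderiv
    (hZ : MDifferentiableAt I I.tangent (fun y => (⟨y, Z y⟩ : TangentBundle I M)) x)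
    (u : TangentSpace I x) :
    tangentPart g gP f x (derivAlong Dbar f (fun y => mfderiv I J f y (Z y)) x u) = D Z x u := by
  refine sub_eq_zero.1 (g.nondegenerate x _ fun v => ?_)
  rw [map_sub, sub_apply, inner_tangentPart, (h.comp_immersion hf).inner_leviCivita hD hZ,
    ← h.form_mvfderiv, mvfderiv_derivAlong_mfderiv h hf hDbar hZ, h.mvfderiv_comp_immersion hf v,
    sub_self]

/- The right-hand side depends on `Z` only through `Z x`, so the extension used in the definition
of `α` may be replaced by `Z`. -/
theorem mvfderiv_secondFundamentalForm
    (hZ : MDifferentiableAt I I.tangent (fun y => (⟨y, Z y⟩ : TangentBundle I M)) x)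
    (u : TangentSpace I x) :
    mvfderiv J ι (f x) (secondFundamentalForm g gP Dbar f x u (Z x)) =
      covDerivAlong I Γ (fun y => ι (f y)) (fun y => mvfderiv I (fun y => ι (f y)) y (Z y)) x u -
        mvfderiv I (fun y => ι (f y)) x (D Z x u) := by
  have hext := FiberBundle.mdifferentiableAt_extend I E (Z x)
  rw [secondFundamentalForm, normalPart, tangentPart_derivAlong_mfderiv h hf hDbar hD hext,
    map_sub, mvfderiv_derivAlong_mfderiv h hf hDbar hext, ← h.mvfderiv_comp_immersion hf]
  exact (h.comp_immersion hf).covDerivAlong_sub_congr hD hext hZ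
    (FiberBundle.extend_apply_self E (Z x)) u

theorem inner_secondFundamentalForm
    (hZ : MDifferentiableAt I I.tangent (fun y => (⟨y, Z y⟩ : TangentBundle I M)) x)
    (u : TangentSpace I x) {w : TangentSpace J (f x)} (hw : IsNormal (I := I) gP f x w) :
    gP (f x) (secondFundamentalForm g gP Dbar f x u (Z x)) w =
      B (ι (f x)) (covDerivAlong I Γ (fun y => ι (f y))
        (fun y => mvfderiv I (fun y => ι (f y)) y (Z y)) x u) (mvfderiv J ι (f x) w) := by
  rw [← h.form_mvfderiv, mvfderiv_secondFundamentalForm h hf hDbar hD hZ, map_sub, sub_apply,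
    h.form_mvfderiv_normal hf hw, sub_zero]

theorem form_mvfderiv_covDerivAlong_normal
    (hZ : MDifferentiableAt I I.tangent (fun y => (⟨y, Z y⟩ : TangentBundle I M)) x)
    (hη : MDifferentiableAt I J.tangent (fun y => (⟨f y, η y⟩ : TangentBundle J P)) x)
    (hη_normal : ∀ᶠ y in 𝓝 x, IsNormal (I := I) gP f y (η y)) (u : TangentSpace I x) :
    B (ι (f x)) (mvfderiv I (fun y => ι (f y)) x (Z x))
        (covDerivAlong I Γ (fun y => ι (f y)) (fun y => mvfderiv J ι (f y) (η y)) x u) =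
      -gP (f x) (secondFundamentalForm g gP Dbar f x u (Z x)) (η x) := by
  have hzero : (fun y => B (ι (f y)) (mvfderiv I (fun y => ι (f y)) y (Z y))
      (mvfderiv J ι (f y) (η y))) =ᶠ[𝓝 x] fun _ => 0 := by
    filter_upwards [hη_normal] with y hy
    exact h.form_mvfderiv_normal hf hy (Z y)
  have hprod := h.mvfderiv_form_along hf ((h.comp_immersion hf).mdifferentiableAt_mvfderiv hZ)
    (h.mdifferentiableAt_mvfderiv_along hf hη) (h.mvfderiv_comp_immersion hf (Z x)).symm rfl u
  rw [mvfderiv_congr_of_eventuallyEq hzero, mvfderiv_const, zero_apply] at hprod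
  rw [inner_secondFundamentalForm h hf hDbar hD hZ u hη_normal.self_of_nhds]
  linarith

theorem inner_secondFundamentalForm_normalConnection
    (hZ : MDifferentiableAt I I.tangent (fun y => (⟨y, Z y⟩ : TangentBundle I M)) x)
    (hη : MDifferentiableAt I J.tangent (fun y => (⟨f y, η y⟩ : TangentBundle J P)) x)
    (hη_normal : ∀ᶠ y in 𝓝 x, IsNormal (I := I) gP f y (η y)) (u v : TangentSpace I x) :
    gP (f x) (secondFundamentalForm g gP Dbar f x u (Z x)) (normalConnection g gP Dbar f η x v) =
      B (ι (f x)) (covDerivAlong I Γ (fun y => ι (f y))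
          (fun y => mvfderiv I (fun y => ι (f y)) y (Z y)) x u)
        (covDerivAlong I Γ (fun y => ι (f y)) (fun y => mvfderiv J ι (f y) (η y)) x v) +
        gP (f x) (secondFundamentalForm g gP Dbar f x v (D Z x u)) (η x) := by
  have hext := FiberBundle.mdifferentiableAt_extend I E (D Z x u)
  have hweingarten := form_mvfderiv_covDerivAlong_normal h hf hDbar hD hext hη hη_normal v
  have hnormal : gP (f x) (secondFundamentalForm g gP Dbar f x u (Z x))
      (mfderiv I J f x (tangentPart g gP f x (derivAlong Dbar f η x v))) = 0 :=
    isNormal_normalPart hf _ _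
  rw [FiberBundle.extend_apply_self] at hweingarten
  rw [normalConnection, normalPart, map_sub, hnormal, sub_zero, ← h.form_mvfderiv,
    mvfderiv_secondFundamentalForm h hf hDbar hD hZ,
    h.mvfderiv_derivAlong hDbar (hf.1.mdifferentiableAt (by simp)) hη, map_sub, sub_apply,
    hweingarten, sub_neg_eq_add]

theorem mvfderiv_inner_secondFundamentalForm
    (hX : MDifferentiableAt I I.tangent (fun y => (⟨y, X y⟩ : TangentBundle I M)) x)
    (hZ : ContMDiffAt I I.tangent 2 (fun y => (⟨y, Z y⟩ : TangentBundle I M)) x)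
    (hη : MDifferentiableAt I J.tangent (fun y => (⟨f y, η y⟩ : TangentBundle J P)) x)
    (hη_normal : ∀ᶠ y in 𝓝 x, IsNormal (I := I) gP f y (η y)) (u : TangentSpace I x) :
    mvfderiv I (fun y => gP (f y) (secondFundamentalForm g gP Dbar f y (X y) (Z y)) (η y)) x u =
      B (ι (f x)) (covDerivAlong I Γ (fun y => ι (f y)) (fun y =>
          covDerivAlong I Γ (fun y => ι (f y))
            (fun y => mvfderiv I (fun y => ι (f y)) y (Z y)) y (X y)) x u)
          (mvfderiv J ι (f x) (η x)) +
        B (ι (f x)) (covDerivAlong I Γ (fun y => ι (f y))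
            (fun y => mvfderiv I (fun y => ι (f y)) y (Z y)) x (X x))
          (covDerivAlong I Γ (fun y => ι (f y)) (fun y => mvfderiv J ι (f y) (η y)) x u) := by
  have hΦ := h.comp_immersion hf
  have hZ' := hZ.mdifferentiableAt two_ne_zero
  have hgauss : (fun y => gP (f y) (secondFundamentalForm g gP Dbar f y (X y) (Z y)) (η y)) =ᶠ[𝓝 x]
      fun y => B (ι (f y)) (covDerivAlong I Γ (fun y => ι (f y))
        (fun y => mvfderiv I (fun y => ι (f y)) y (Z y)) y (X y)) (mvfderiv J ι (f y) (η y)) := by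
    filter_upwards [hη_normal, (contMDiffAt_iff_contMDiffAt_nhds (by simp)).1 hZ] with y hy hZy
    exact inner_secondFundamentalForm h hf hDbar hD (hZy.mdifferentiableAt two_ne_zero) (X y) hy
  rw [mvfderiv_congr_of_eventuallyEq hgauss]
  exact h.mvfderiv_form_along hf
    (mdifferentiableAt_covDerivAlong (h.differentiableAt_christoffel (f x))
      ((hΦ.contMDiff x).of_le ENat.LEInfty.out) (hΦ.contMDiffAt_mvfderiv hZ) hX)
    (h.mdifferentiableAt_mvfderiv_along hf hη)
    (mvfderiv_derivAlong_mfderiv h hf hDbar hZ' (X x)) rfl u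

theorem covDerivSecondFundamentalForm_eq
    (hX : MDifferentiableAt I I.tangent (fun y => (⟨y, X y⟩ : TangentBundle I M)) x)
    (hZ : ContMDiffAt I I.tangent 2 (fun y => (⟨y, Z y⟩ : TangentBundle I M)) x)
    (hη : MDifferentiableAt I J.tangent (fun y => (⟨f y, η y⟩ : TangentBundle J P)) x)
    (hη_normal : ∀ᶠ y in 𝓝 x, IsNormal (I := I) gP f y (η y)) :
    covDerivSecondFundamentalForm g gP Dbar f D Y X Z η x =
      B (ι (f x)) (covDerivAlong I Γ (fun y => ι (f y)) (fun y =>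
          covDerivAlong I Γ (fun y => ι (f y))
            (fun y => mvfderiv I (fun y => ι (f y)) y (Z y)) y (X y)) x (Y x) -
          covDerivAlong I Γ (fun y => ι (f y))
            (fun y => mvfderiv I (fun y => ι (f y)) y (Z y)) x (D X x (Y x)))
          (mvfderiv J ι (f x) (η x)) -
        gP (f x) (secondFundamentalForm g gP Dbar f x (X x) (D Z x (Y x))) (η x) -
        gP (f x) (secondFundamentalForm g gP Dbar f x (Y x) (D Z x (X x))) (η x) := by
  have hZ' := hZ.mdifferentiableAt two_ne_zero
  rw [covDerivSecondFundamentalForm,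
    mvfderiv_inner_secondFundamentalForm h hf hDbar hD hX hZ hη hη_normal,
    inner_secondFundamentalForm h hf hDbar hD hZ' _ hη_normal.self_of_nhds,
    inner_secondFundamentalForm_normalConnection h hf hDbar hD hZ' hη hη_normal, map_sub,
    sub_apply]
  ring

theorem covDerivSecondFundamentalForm_sub
    (hX : MDifferentiableAt I I.tangent (fun y => (⟨y, X y⟩ : TangentBundle I M)) x)
    (hY : MDifferentiableAt I I.tangent (fun y => (⟨y, Y y⟩ : TangentBundle I M)) x)
    (hZ : ContMDiffAt I I.tangent 2 (fun y => (⟨y, Z y⟩ : TangentBundle I M)) x)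
    (hη : MDifferentiableAt I J.tangent (fun y => (⟨f y, η y⟩ : TangentBundle J P)) x)
    (hη_normal : ∀ᶠ y in 𝓝 x, IsNormal (I := I) gP f y (η y)) :
    covDerivSecondFundamentalForm g gP Dbar f D Y X Z η x -
        covDerivSecondFundamentalForm g gP Dbar f D X Y Z η x =
      B (ι (f x)) (christoffelCurvature Γ (ι (f x)) (mvfderiv J ι (f x) (mfderiv I J f x (Y x)))
        (mvfderiv J ι (f x) (mfderiv I J f x (X x)))
        (mvfderiv J ι (f x) (mfderiv I J f x (Z x)))) (mvfderiv J ι (f x) (η x)) := by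
  have := FiniteDimensional.complete ℝ E
  have hΦ := h.comp_immersion hf
  have hcurv := covDerivAlong_covDerivAlong_sub (Φ := fun y => ι (f y))
    (hΦ.differentiableAt_christoffel x) ((hΦ.contMDiff x).of_le ENat.LEInfty.out)
    (hΦ.contMDiffAt_mvfderiv hZ) hX hY
  rw [← hD.sub_eq_mlieBracket hY hX, map_sub, ← sub_eq_iff_eq_add', sub_sub_sub_comm] at hcurv
  simp only [← h.mvfderiv_comp_immersion hf]
  rw [covDerivSecondFundamentalForm_eq h hf hDbar hD hX hZ hη hη_normal,
    covDerivSecondFundamentalForm_eq h hf hDbar hD hY hZ hη hη_normal, ← hcurv]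
  simp only [map_sub, sub_apply]
  ring

end Immersion

section Cone

variable {W : Type*} [NormedAddCommGroup W] [NormedSpace ℝ W]

/-- The form `ε dt² + a(t)² h` on `ℝ × W`, at the point `q = (t, p)`. -/
def warpForm (ε : ℝ) (a : ℝ → ℝ) (h : W →L[ℝ] W →L[ℝ] ℝ) (q : ℝ × W) :
    ℝ × W →L[ℝ] ℝ × W →L[ℝ] ℝ :=
  ε • (ContinuousLinearMap.fst ℝ ℝ W).smulRight (ContinuousLinearMap.fst ℝ ℝ W) +
    a q.1 ^ 2 • pullForm h (ContinuousLinearMap.snd ℝ ℝ W)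

/-- The bilinear map `(v, w) ↦ (0, v₁ w₂ + w₁ v₂)` on `ℝ × W`. -/
def mixedProduct (W : Type*) [NormedAddCommGroup W] [NormedSpace ℝ W] :
    ℝ × W →L[ℝ] ℝ × W →L[ℝ] ℝ × W :=
  let B := (ContinuousLinearMap.fst ℝ ℝ W).smulRight
    ((ContinuousLinearMap.inr ℝ ℝ W).comp (ContinuousLinearMap.snd ℝ ℝ W))
  B + B.flip

/-- The bilinear map `(v, w) ↦ h(v₂, w₂) z` on `ℝ × W`, as a linear function of `z`. -/
def formSMul (h : W →L[ℝ] W →L[ℝ] ℝ) : ℝ × W →L[ℝ] ℝ × W →L[ℝ] ℝ × W →L[ℝ] ℝ × W :=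
  (ContinuousLinearMap.precomp (ℝ × W →L[ℝ] ℝ × W)
    (pullForm h (ContinuousLinearMap.snd ℝ ℝ W))).comp
    (ContinuousLinearMap.smulRightL ℝ (ℝ × W) (ℝ × W)).flip

/-- The Christoffel form on `ℝ × W` of the warped product over the hyperquadric `h(p, p) = c` of
`W`: the terms in `a'` come from the warping and `c h(v₂, w₂) p` is the second fundamental form of
the hyperquadric, up to sign. It induces the Levi-Civita connection only along the hyperquadric. -/
def warpChristoffel (ε c : ℝ) (a : ℝ → ℝ) (h : W →L[ℝ] W →L[ℝ] ℝ) (q : ℝ × W) :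
    ℝ × W →L[ℝ] ℝ × W →L[ℝ] ℝ × W :=
  formSMul h (-(ε * (a q.1 * deriv a q.1)), c • q.2) + (deriv a q.1 / a q.1) • mixedProduct W

variable {ε c : ℝ} {a : ℝ → ℝ} {h : W →L[ℝ] W →L[ℝ] ℝ} {q : ℝ × W}

theorem warpForm_apply (v w : ℝ × W) :
    warpForm ε a h q v w = ε * (v.1 * w.1) + a q.1 ^ 2 * h v.2 w.2 :=
  rfl

theorem warpChristoffel_apply (v w : ℝ × W) :
    warpChristoffel ε c a h q v w = (-(ε * (a q.1 * deriv a q.1)) * h v.2 w.2,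
      (deriv a q.1 / a q.1) • (v.1 • w.2 + w.1 • v.2) + (c * h v.2 w.2) • q.2) := by
  have hform (z : ℝ × W) : formSMul h z v w = h v.2 w.2 • z := rfl
  have hmixed : mixedProduct W v w = (v.1 • (0 : ℝ) + w.1 • (0 : ℝ), v.1 • w.2 + w.1 • v.2) := rfl
  simp only [warpChristoffel, add_apply, smul_apply, hform, hmixed]
  ext1 <;> simp [mul_comm, add_comm, smul_smul]

theorem warpForm_symm (hh : ∀ v w, h v w = h w v) (v w : ℝ × W) :
    warpForm ε a h q v w = warpForm ε a h q w v := by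
  rw [warpForm_apply, warpForm_apply, hh, mul_comm v.1]

theorem warpChristoffel_symm (hh : ∀ v w, h v w = h w v) (v w : ℝ × W) :
    warpChristoffel ε c a h q v w = warpChristoffel ε c a h q w v := by
  rw [warpChristoffel_apply, warpChristoffel_apply, hh, add_comm (v.1 • w.2)]

theorem fderiv_apply_apply {V₁ V₂ V₃ V₄ : Type*} [NormedAddCommGroup V₁] [NormedSpace ℝ V₁]
    [NormedAddCommGroup V₂] [NormedSpace ℝ V₂] [NormedAddCommGroup V₃] [NormedSpace ℝ V₃]
    [NormedAddCommGroup V₄] [NormedSpace ℝ V₄] {A : V₁ → V₂ →L[ℝ] V₃ →L[ℝ] V₄} {p : V₁}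
    (hA : DifferentiableAt ℝ A p) (u : V₁) (v : V₂) (w : V₃) :
    fderiv ℝ A p u v w = fderiv ℝ (fun r => A r v w) p u := by
  rw [((hA.hasFDerivAt.clm_apply (hasFDerivAt_const v p)).clm_apply
    (hasFDerivAt_const w p)).fderiv]
  simp

theorem hasFDerivAt_comp_fst {b : ℝ → ℝ} {b' : ℝ} (hb : HasDerivAt b b' q.1) :
    HasFDerivAt (fun p : ℝ × W => b p.1) (b' • ContinuousLinearMap.fst ℝ ℝ W) q :=
  hb.comp_hasFDerivAt q hasFDerivAt_fst

theorem differentiableAt_clm_add_smul {V G : Type*} [NormedAddCommGroup V] [NormedSpace ℝ V]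
    [NormedAddCommGroup G] [NormedSpace ℝ G] {z : ℝ × W → V} {b : ℝ → ℝ}
    (L : V →L[ℝ] G) (S : G) (hz : DifferentiableAt ℝ z q) (hb : DifferentiableAt ℝ b q.1) :
    DifferentiableAt ℝ (fun p => L (z p) + b p.1 • S) q :=
  (L.differentiableAt.comp q hz).add
    ((hasFDerivAt_comp_fst hb.hasDerivAt).differentiableAt.smul_const S)

theorem differentiableAt_warpForm (ha : DifferentiableAt ℝ a q.1) :
    DifferentiableAt ℝ (warpForm ε a h) q :=
  differentiableAt_clm_add_smul (G := ℝ × W →L[ℝ] ℝ × W →L[ℝ] ℝ)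
    ((ContinuousLinearMap.id ℝ ℝ).smulRight
      ((ContinuousLinearMap.fst ℝ ℝ W).smulRight (ContinuousLinearMap.fst ℝ ℝ W)))
    (pullForm h (ContinuousLinearMap.snd ℝ ℝ W)) (differentiableAt_const ε) (ha.fun_pow 2)

theorem differentiableAt_warpChristoffel (ha : DifferentiableAt ℝ a q.1)
    (ha' : DifferentiableAt ℝ (deriv a) q.1) (ha0 : a q.1 ≠ 0) :
    DifferentiableAt ℝ (warpChristoffel ε c a h) q := by
  have hprod := hasFDerivAt_comp_fst (W := W)
    ((ha.hasDerivAt.fun_mul ha'.hasDerivAt).const_mul ε).fun_neg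
  have hcoeff : DifferentiableAt ℝ (fun p : ℝ × W =>
      (-(ε * (a p.1 * deriv a p.1)), c • p.2)) q :=
    hprod.differentiableAt.prodMk (differentiableAt_snd.const_smul c)
  have hsum := differentiableAt_clm_add_smul (G := ℝ × W →L[ℝ] ℝ × W →L[ℝ] ℝ × W)
    (formSMul h) (mixedProduct W) hcoeff (ha'.fun_div ha ha0)
  exact hsum

theorem fderiv_warpForm_apply (ha : DifferentiableAt ℝ a q.1) (u v w : ℝ × W) :
    fderiv ℝ (warpForm ε a h) q u v w = 2 * (a q.1 * deriv a q.1) * u.1 * h v.2 w.2 := by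
  rw [fderiv_apply_apply (differentiableAt_warpForm ha)]
  simp only [warpForm_apply]
  rw [(((hasFDerivAt_comp_fst (ha.hasDerivAt.fun_pow 2)).mul_const (h v.2 w.2)).const_add
    (ε * (v.1 * w.1))).fderiv]
  simp only [smul_apply, ContinuousLinearMap.coe_fst', smul_eq_mul]
  ring

theorem fderiv_warpChristoffel_apply (ha : DifferentiableAt ℝ a q.1)
    (ha' : DifferentiableAt ℝ (deriv a) q.1) (ha0 : a q.1 ≠ 0) (u v w : ℝ × W) :
    fderiv ℝ (warpChristoffel ε c a h) q u v w =
      (-(ε * (deriv a q.1 * deriv a q.1 + a q.1 * deriv (deriv a) q.1)) * u.1 * h v.2 w.2,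
        ((deriv (deriv a) q.1 * a q.1 - deriv a q.1 * deriv a q.1) / a q.1 ^ 2 * u.1) •
          (v.1 • w.2 + w.1 • v.2) + (c * h v.2 w.2) • u.2) := by
  have hprod := ((ha.hasDerivAt.fun_mul ha'.hasDerivAt).const_mul ε).fun_neg
  have hquot := ha'.hasDerivAt.fun_div ha.hasDerivAt ha0
  rw [fderiv_apply_apply (differentiableAt_warpChristoffel ha ha' ha0)]
  simp only [warpChristoffel_apply]
  rw [(((hasFDerivAt_comp_fst hprod).mul_const (h v.2 w.2)).prodMk
    (((hasFDerivAt_comp_fst hquot).smul_const (v.1 • w.2 + w.1 • v.2)).fun_add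
      (hasFDerivAt_snd.fun_const_smul (c * h v.2 w.2)))).fderiv]
  ext1 <;> simp [mul_comm]

theorem fderiv_warpForm_eq_christoffel (hh : ∀ v w, h v w = h w v) (hε : ε * ε = 1)
    (ha : DifferentiableAt ℝ a q.1) (ha0 : a q.1 ≠ 0) {u v w : ℝ × W}
    (hv : h q.2 v.2 = 0) (hw : h q.2 w.2 = 0) :
    fderiv ℝ (warpForm ε a h) q u v w =
      warpForm ε a h q (warpChristoffel ε c a h q u v) w +
        warpForm ε a h q v (warpChristoffel ε c a h q u w) := by
  have hcancel : a q.1 ^ 2 * (deriv a q.1 / a q.1) = a q.1 * deriv a q.1 := by field_simp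
  have hv' : h v.2 q.2 = 0 := by rw [hh, hv]
  rw [fderiv_warpForm_apply ha]
  simp only [warpForm_apply, warpChristoffel_apply, smul_eq_mul, map_add, map_smul, add_apply,
    smul_apply, hv', hw, hh v.2 u.2]
  linear_combination (a q.1 * deriv a q.1 * (h u.2 v.2 * w.1 + h u.2 w.2 * v.1)) * hε -
    (2 * u.1 * h v.2 w.2 + v.1 * h u.2 w.2 + w.1 * h u.2 v.2) * hcancel

theorem warpForm_christoffelCurvature (hh : ∀ v w, h v w = h w v) (hε : ε * ε = 1)
    (ha : DifferentiableAt ℝ a q.1) (ha' : DifferentiableAt ℝ (deriv a) q.1) (ha0 : a q.1 ≠ 0)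
    {u v w z : ℝ × W} (hu : h q.2 u.2 = 0) (hv : h q.2 v.2 = 0) (hz : h q.2 z.2 = 0)
    (huz : warpForm ε a h q u z = 0) (hvz : warpForm ε a h q v z = 0) :
    warpForm ε a h q (christoffelCurvature (warpChristoffel ε c a h) q u v w) z =
      (deriv (deriv a) q.1 / a q.1 - deriv a q.1 ^ 2 / a q.1 ^ 2 + ε * c / a q.1 ^ 2) * z.1 *
        (v.1 * warpForm ε a h q u w - u.1 * warpForm ε a h q v w) := by
  obtain ⟨b, hb⟩ : ∃ b, deriv a q.1 = b * a q.1 := ⟨deriv a q.1 / a q.1, by field_simp⟩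
  obtain ⟨b', hb'⟩ : ∃ b', deriv (deriv a) q.1 = (b' + b ^ 2) * a q.1 :=
    ⟨deriv (deriv a) q.1 / a q.1 - b ^ 2, by field_simp; ring⟩
  have hlog : deriv a q.1 / a q.1 = b := by rw [hb]; field_simp
  have hlog' : (deriv (deriv a) q.1 * a q.1 - deriv a q.1 * deriv a q.1) / a q.1 ^ 2 = b' := by
    rw [hb, hb']; field_simp; ring
  have hcoeff : deriv (deriv a) q.1 / a q.1 - deriv a q.1 ^ 2 / a q.1 ^ 2 = b' := by
    rw [hb, hb']; field_simp; ring
  obtain ⟨r, hr⟩ : ∃ r, ε * c / a q.1 ^ 2 = r := ⟨_, rfl⟩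
  have hr' : r * a q.1 ^ 2 = ε * c := by rw [← hr]; field_simp
  have hu' : h u.2 q.2 = 0 := by rw [hh, hu]
  have hv' : h v.2 q.2 = 0 := by rw [hh, hv]
  rw [warpForm_apply] at huz hvz
  simp only [christoffelCurvature, fderiv_warpChristoffel_apply ha ha' ha0, warpForm_apply,
    warpChristoffel_apply, hlog, hlog', hcoeff, hr, map_add, map_sub, map_smul, add_apply,
    sub_apply, smul_apply, smul_eq_mul, hz, hu', hv', hh v.2 u.2]
  rw [hb, hb']
  linear_combination
    ((b' + b ^ 2) * w.1 * u.1 - (c - ε * (b * a q.1) ^ 2) * h u.2 w.2) * hvz +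
    (-(b' + b ^ 2) * w.1 * v.1 + (c - ε * (b * a q.1) ^ 2) * h v.2 w.2) * huz +
    z.1 * (v.1 * h u.2 w.2 - u.1 * h v.2 w.2) * (a q.1 ^ 2 * b' * hε - hr')

end Cone

section ConeTangency

variable {E : Type*} [NormedAddCommGroup E] [NormedSpace ℝ E]
  {H : Type*} [TopologicalSpace H] {I : ModelWithCorners ℝ E H}
  {M : Type*} [TopologicalSpace M] [ChartedSpace H M]
  {W : Type*} [NormedAddCommGroup W] [NormedSpace ℝ W] {h : W →L[ℝ] W →L[ℝ] ℝ} {a : ℝ → ℝ}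
  {ε c : ℝ}

theorem apply_snd_mvfderiv_snd {Φ S : M → ℝ × W} {x : M}
    (hΦ : MDifferentiableAt I 𝓘(ℝ, ℝ × W) Φ x) (hS : MDifferentiableAt I 𝓘(ℝ, ℝ × W) S x)
    (hperp : ∀ y, h (Φ y).2 (S y).2 = 0) (u : TangentSpace I x) :
    h (Φ x).2 (mvfderiv I S x u).2 = -h (mvfderiv I Φ x u).2 (S x).2 := by
  let A : ℝ × W →L[ℝ] ℝ × W →L[ℝ] ℝ := pullForm h (ContinuousLinearMap.snd ℝ ℝ W)
  have hA : mvfderiv I (fun y => A (Φ y)) x u = A (mvfderiv I Φ x u) := by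
    rw [mvfderiv_fderiv_comp_apply A.differentiableAt hΦ, A.fderiv]
  have hAΦ : MDifferentiableAt I 𝓘(ℝ, ℝ × W →L[ℝ] ℝ) (fun y => A (Φ y)) x :=
    A.differentiableAt.mdifferentiableAt.comp x hΦ
  have hprod : mvfderiv I (fun y => A (Φ y) (S y)) x u =
      A (mvfderiv I Φ x u) (S x) + A (Φ x) (mvfderiv I S x u) := by
    rw [mvfderiv_clm_apply hAΦ hS, hA]
  have hzero : (fun y => A (Φ y) (S y)) = fun _ => 0 := funext hperp
  rw [hzero, mvfderiv_const] at hprod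
  exact eq_neg_of_add_eq_zero_right hprod.symm

theorem apply_snd_covDerivAlong_snd (hc : c * c = 1) {Φ S : M → ℝ × W} {x : M}
    (hΦ : MDifferentiableAt I 𝓘(ℝ, ℝ × W) Φ x) (hS : MDifferentiableAt I 𝓘(ℝ, ℝ × W) S x)
    (hΦ_self : h (Φ x).2 (Φ x).2 = c) (hperp : ∀ y, h (Φ y).2 (S y).2 = 0)
    {u : TangentSpace I x} (hu : h (Φ x).2 (mvfderiv I Φ x u).2 = 0) :
    h (Φ x).2 (covDerivAlong I (warpChristoffel ε c a h) Φ S x u).2 = 0 := by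
  have hmixed : h (Φ x).2 (warpChristoffel ε c a h (Φ x) (mvfderiv I Φ x u) (S x)).2 =
      h (mvfderiv I Φ x u).2 (S x).2 := by
    rw [warpChristoffel_apply]
    simp only [map_add, map_smul, smul_eq_mul, hu, hperp, hΦ_self]
    linear_combination h (mvfderiv I Φ x u).2 (S x).2 * hc
  rw [covDerivAlong_apply, Prod.snd_add, map_add, hmixed,
    apply_snd_mvfderiv_snd hΦ hS hperp, neg_add_cancel]

end ConeTangency

section Opens

variable {E : Type*} [NormedAddCommGroup E] [NormedSpace ℝ E]
  {H : Type*} [TopologicalSpace H] {I : ModelWithCorners ℝ E H}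
  {M : Type*} [TopologicalSpace M] [ChartedSpace H M]
  {F : Type*} [NormedAddCommGroup F] [NormedSpace ℝ F]

theorem writtenInExtChartAt_comp_subtype_val {U : TopologicalSpace.Opens M} (h : M → F) (x : U) :
    writtenInExtChartAt I 𝓘(ℝ, F) x (fun y : U => h y) =ᶠ[𝓝 (extChartAt I (x : M) x)]
      writtenInExtChartAt I 𝓘(ℝ, F) (x : M) h := by
  have hchart : (chartAt H (x : M)).symm =ᶠ[𝓝 (I.symm (extChartAt I (x : M) x))]
      Subtype.val ∘ (chartAt H x).symm := by
    simpa [extChartAt] using U.chartAt_subtype_val_symm_eventuallyEq (H := H) (x := x)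
  filter_upwards [I.continuous_symm.continuousAt.eventually hchart] with z hz
  simp only [writtenInExtChartAt, extChartAt_coe_symm, Function.comp_apply] at hz ⊢
  rw [hz]

theorem mvfderiv_comp_subtype_val {U : TopologicalSpace.Opens M} {h : M → F} {x : U}
    (hh : MDifferentiableAt I 𝓘(ℝ, F) h x) (u : E) :
    mvfderiv I (fun y : U => h y) x u = mvfderiv I h (x : M) u := by
  have hval : MDifferentiableAt I I (Subtype.val : U → M) x :=
    (contMDiff_subtype_val (n := ∞) x).mdifferentiableAt (by simp)
  have hrestrict : MDifferentiableAt I 𝓘(ℝ, F) (fun y : U => h y) x := hh.comp x hval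
  have hwritten := writtenInExtChartAt_comp_subtype_val (I := I) h x
  have hcenter : extChartAt I x x = extChartAt I (x : M) x := rfl
  rw [hrestrict.mvfderiv, hh.mvfderiv, hcenter,
    (hwritten.filter_mono nhdsWithin_le_nhds).fderivWithin_eq hwritten.self_of_nhds]
  rfl

end Opens

section Hyperquadric

variable {N ν : ℕ} {c : ℤˣ}

theorem Quadric.height_zero (p : Quadric N ν c) : p.height 0 = 1 := by
  simp [Quadric.height]

theorem Quadric.hasFDerivAt_height (p : Quadric N ν c) :
    HasFDerivAt p.height (0 : EuclideanSpace ℝ (Fin N) →L[ℝ] ℝ) 0 := by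
  have hform : HasFDerivAt (fun y => flatMetric N ν (p.ofPerp y) (p.ofPerp y))
      (0 : EuclideanSpace ℝ (Fin N) →L[ℝ] ℝ) 0 :=
    (((flatMetric N ν).comp p.ofPerp).hasFDerivAt.clm_apply p.ofPerp.hasFDerivAt).congr_fderiv
      (by ext; simp)
  exact ((hform.const_mul ((c : ℤ) : ℝ)).const_sub 1).congr_fderiv (by simp)

theorem Quadric.hasFDerivAt_lift (p : Quadric N ν c) : HasFDerivAt p.lift p.ofPerp 0 := by
  have hsqrt := p.hasFDerivAt_height.sqrt (by simp [p.height_zero])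
  exact (p.ofPerp.hasFDerivAt.add (hsqrt.smul_const (p : Ambient N))).congr_fderiv (by ext; simp)

theorem Quadric.contDiffAt_lift (p : Quadric N ν c) {n : ℕ∞ω} {y : EuclideanSpace ℝ (Fin N)}
    (hy : p.height y ≠ 0) : ContDiffAt ℝ n p.lift y :=
  p.ofPerp.contDiff.contDiffAt.add ((p.contDiff_height.contDiffAt.sqrt hy).smul contDiffAt_const)

theorem Quadric.writtenInExtChartAt_val (p : Quadric N ν c) :
    writtenInExtChartAt (𝓡 N) 𝓘(ℝ, Ambient N) p Quadric.val =ᶠ[𝓝 0] p.lift := by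
  have hpos : ∀ᶠ y in 𝓝 (0 : EuclideanSpace ℝ (Fin N)), 0 < p.height y :=
    p.hasFDerivAt_height.continuousAt.eventually (lt_mem_nhds (by simp [p.height_zero]))
  filter_upwards [hpos] with y hy
  change ((p.chart.symm y : Quadric N ν c) : Ambient N) = p.lift y
  simp [Quadric.chart, dif_pos hy]

theorem Quadric.extChartAt_self (p : Quadric N ν c) : extChartAt (𝓡 N) p p = 0 :=
  p.toPerp_self

theorem Quadric.contMDiff_val :
    ContMDiff (𝓡 N) 𝓘(ℝ, Ambient N) ∞ (Quadric.val : Quadric N ν c → Ambient N) := by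
  intro p
  refine contMDiffAt_iff.2 ⟨Quadric.continuous_val.continuousAt, ?_⟩
  rw [p.extChartAt_self]
  exact ((p.contDiffAt_lift (by simp [p.height_zero])).congr_of_eventuallyEq
    p.writtenInExtChartAt_val).contDiffWithinAt

theorem Quadric.mvfderiv_val (p : Quadric N ν c) (u : EuclideanSpace ℝ (Fin N)) :
    mvfderiv (𝓡 N) (Quadric.val : Quadric N ν c → Ambient N) p u = p.ofPerp u := by
  rw [(Quadric.contMDiff_val.mdifferentiable (by simp) p).mvfderiv, p.extChartAt_self,
    (𝓡 N).range_eq_univ, fderivWithin_univ, p.writtenInExtChartAt_val.fderiv_eq,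
    p.hasFDerivAt_lift.fderiv]
  rfl

theorem flatMetric_nondegenerate {x : Ambient N} (hx : ∀ y, flatMetric N ν x y = 0) : x = 0 := by
  ext i
  have hi := hx (EuclideanSpace.single i 1)
  rw [flatMetric_apply, Finset.sum_eq_single i (fun j _ hj => by simp [hj]) (by simp)] at hi
  split_ifs at hi <;> simpa using hi

variable {o : Quadric N ν c}

theorem contMDiff_spaceForm_val :
    ContMDiff (𝓡 N) 𝓘(ℝ, Ambient N) ∞
      (fun p : spaceForm o => ((p : Quadric N ν c) : Ambient N)) :=
  Quadric.contMDiff_val.comp contMDiff_subtype_val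

theorem mvfderiv_spaceForm_val (p : spaceForm o) (u : EuclideanSpace ℝ (Fin N)) :
    mvfderiv (𝓡 N) (fun p : spaceForm o => ((p : Quadric N ν c) : Ambient N)) p u =
      (p : Quadric N ν c).ofPerp u :=
  (mvfderiv_comp_subtype_val (I := 𝓡 N) (h := Quadric.val)
    (Quadric.contMDiff_val.mdifferentiable (by simp) _) u).trans (Quadric.mvfderiv_val _ u)

end Hyperquadric

section WarpedProduct

variable {N ν : ℕ} {ε c : ℤˣ} {J : TopologicalSpace.Opens ℝ} {o : Quadric N ν c} {a : ℝ → ℝ}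

variable (J o) in
/-- The inclusion of the warped product over the space form through `o` in `ℝ × ℝ^{N+1}`. -/
def warpIncl (q : J × spaceForm o) : ℝ × Ambient N :=
  ((q.1 : ℝ), ((q.2 : Quadric N ν c) : Ambient N))

theorem contMDiff_warpIncl :
    ContMDiff (𝓘(ℝ, ℝ).prod (𝓡 N)) 𝓘(ℝ, ℝ × Ambient N) ∞ (warpIncl J o) :=
  ContMDiff.prodMk_space (contMDiff_subtype_val.comp contMDiff_fst)
    (contMDiff_spaceForm_val.comp contMDiff_snd)

theorem flatMetric_warpIncl (q : J × spaceForm o) :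
    flatMetric N ν (warpIncl J o q).2 (warpIncl J o q).2 = ((c : ℤ) : ℝ) :=
  (q.2 : Quadric N ν c).self_eq

theorem mvfderiv_fst_val (q : J × spaceForm o) (v : TangentSpace (𝓘(ℝ, ℝ).prod (𝓡 N)) q) :
    mvfderiv (𝓘(ℝ, ℝ).prod (𝓡 N)) (fun r : J × spaceForm o => (r.1 : ℝ)) q v = v.1 := by
  have hval : MDifferentiableAt 𝓘(ℝ, ℝ) 𝓘(ℝ, ℝ) (fun t : J => (t : ℝ)) q.1 :=
    contMDiff_subtype_val.mdifferentiableAt one_ne_zero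
  have hchain := mvfderiv_fun_comp_apply (I := 𝓘(ℝ, ℝ).prod (𝓡 N)) hval
    (mdifferentiableAt_fst (x := q)) v
  rw [mfderiv_fst] at hchain
  refine hchain.trans ((mvfderiv_comp_subtype_val (I := 𝓘(ℝ, ℝ)) (h := fun t : ℝ => t)
    mdifferentiableAt_id v.1).trans ?_)
  rw [mvfderiv, mfderiv_eq_fderiv, fderiv_fun_id]
  rfl

theorem mvfderiv_snd_val (q : J × spaceForm o) (v : TangentSpace (𝓘(ℝ, ℝ).prod (𝓡 N)) q) :
    mvfderiv (𝓘(ℝ, ℝ).prod (𝓡 N))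
      (fun r : J × spaceForm o => ((r.2 : Quadric N ν c) : Ambient N)) q v =
      (q.2 : Quadric N ν c).ofPerp v.2 := by
  have hchain := mvfderiv_fun_comp_apply (I := 𝓘(ℝ, ℝ).prod (𝓡 N))
    (contMDiff_spaceForm_val.mdifferentiable (by simp) q.2) (mdifferentiableAt_snd (x := q)) v
  rw [mfderiv_snd] at hchain
  exact hchain.trans (mvfderiv_spaceForm_val q.2 v.2)

theorem mvfderiv_warpIncl_apply (q : J × spaceForm o) (v : TangentSpace (𝓘(ℝ, ℝ).prod (𝓡 N)) q) :
    mvfderiv (𝓘(ℝ, ℝ).prod (𝓡 N)) (warpIncl J o) q v =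
      (v.1, (q.2 : Quadric N ν c).ofPerp v.2) := by
  have hι := contMDiff_warpIncl.mdifferentiable (by simp) q
  have hfst := mvfderiv_fderiv_comp_apply differentiableAt_fst hι v
  have hsnd := mvfderiv_fderiv_comp_apply differentiableAt_snd hι v
  rw [fderiv_fst] at hfst
  rw [fderiv_snd] at hsnd
  exact Prod.ext (hfst.symm.trans (mvfderiv_fst_val q v)) (hsnd.symm.trans (mvfderiv_snd_val q v))

theorem ambientMetric_eq_warpForm (q : J × spaceForm o)
    (v w : TangentSpace (𝓘(ℝ, ℝ).prod (𝓡 N)) q) :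
    ambientMetric ε J a o q v w = warpForm ((ε : ℤ) : ℝ) a (flatMetric N ν) (warpIncl J o q)
      (mvfderiv (𝓘(ℝ, ℝ).prod (𝓡 N)) (warpIncl J o) q v)
      (mvfderiv (𝓘(ℝ, ℝ).prod (𝓡 N)) (warpIncl J o) q w) := by
  have hmetric : ambientMetric ε J a o q v w =
      ((ε : ℤ) : ℝ) * (mvfderiv (𝓘(ℝ, ℝ).prod (𝓡 N)) (fun r : J × spaceForm o => (r.1 : ℝ)) q v *
        mvfderiv (𝓘(ℝ, ℝ).prod (𝓡 N)) (fun r : J × spaceForm o => (r.1 : ℝ)) q w) +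
      a q.1 ^ 2 * spaceFormMetric o q.2
        (mfderiv (𝓘(ℝ, ℝ).prod (𝓡 N)) (𝓡 N) Prod.snd q v)
        (mfderiv (𝓘(ℝ, ℝ).prod (𝓡 N)) (𝓡 N) Prod.snd q w) := rfl
  have hform (x y : EuclideanSpace ℝ (Fin N)) : spaceFormMetric o q.2 x y =
      flatMetric N ν ((q.2 : Quadric N ν c).ofPerp x) ((q.2 : Quadric N ν c).ofPerp y) :=
    congrArg₂ (flatMetric N ν · ·) (mvfderiv_spaceForm_val q.2 x) (mvfderiv_spaceForm_val q.2 y)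
  rw [hmetric, mvfderiv_fst_val, mvfderiv_fst_val, mfderiv_snd, mvfderiv_warpIncl_apply,
    mvfderiv_warpIncl_apply]
  exact congrArg _ (congrArg _ (hform v.2 w.2))

theorem ambientMetric_symm (q : J × spaceForm o)
    (v w : TangentSpace (𝓘(ℝ, ℝ).prod (𝓡 N)) q) :
    ambientMetric ε J a o q v w = ambientMetric ε J a o q w v := by
  rw [ambientMetric_eq_warpForm, ambientMetric_eq_warpForm, warpForm_symm (flatMetric_symm N ν)]

theorem flatMetric_mvfderiv_warpIncl (q : J × spaceForm o)
    (v : TangentSpace (𝓘(ℝ, ℝ).prod (𝓡 N)) q) :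
    flatMetric N ν (warpIncl J o q).2
      (mvfderiv (𝓘(ℝ, ℝ).prod (𝓡 N)) (warpIncl J o) q v).2 = 0 := by
  rw [mvfderiv_warpIncl_apply]
  exact Quadric.flatMetric_ofPerp _ _

theorem mem_range_mvfderiv_warpIncl (q : J × spaceForm o) {z : ℝ × Ambient N}
    (hz : flatMetric N ν (warpIncl J o q).2 z.2 = 0) :
    z ∈ range (mvfderiv (𝓘(ℝ, ℝ).prod (𝓡 N)) (warpIncl J o) q) := by
  refine ⟨((z.1, (q.2 : Quadric N ν c).toPerp z.2) : ℝ × EuclideanSpace ℝ (Fin N)), ?_⟩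
  have hz' : flatMetric N ν ((q.2 : Quadric N ν c) : Ambient N) z.2 = 0 := hz
  refine (mvfderiv_warpIncl_apply q _).trans ?_
  rw [Quadric.ofPerp_toPerp, hz', mul_zero, zero_smul, sub_zero]

theorem mvfderiv_warpIncl_partialT (q : J × spaceForm o) :
    mvfderiv (𝓘(ℝ, ℝ).prod (𝓡 N)) (warpIncl J o) q (partialT (𝓡 N) J q) = (1, 0) :=
  (mvfderiv_warpIncl_apply q _).trans (by simp [partialT])

theorem ambientMetric_partialT (q : J × spaceForm o)
    (w : TangentSpace (𝓘(ℝ, ℝ).prod (𝓡 N)) q) :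
    ambientMetric ε J a o q (partialT (𝓡 N) J q) w =
      ((ε : ℤ) : ℝ) * (mvfderiv (𝓘(ℝ, ℝ).prod (𝓡 N)) (warpIncl J o) q w).1 := by
  rw [ambientMetric_eq_warpForm, mvfderiv_warpIncl_partialT, warpForm_apply]
  simp

theorem eq_zero_of_flatMetric_ofPerp (p : Quadric N ν c) {x : EuclideanSpace ℝ (Fin N)}
    (hx : ∀ y, flatMetric N ν (p.ofPerp x) (p.ofPerp y) = 0) : x = 0 := by
  have hofPerp : p.ofPerp x = 0 := flatMetric_nondegenerate (ν := ν) fun y => by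
    have hy := hx (p.toPerp y)
    rwa [p.ofPerp_toPerp, map_sub, map_smul, flatMetric_symm N ν _ (p : Ambient N),
      p.flatMetric_ofPerp, smul_zero, sub_zero] at hy
  rw [← p.toPerp_ofPerp x, hofPerp, map_zero]

theorem ambientMetric_nondegenerate {q : J × spaceForm o} (ha0 : a q.1 ≠ 0)
    {v : TangentSpace (𝓘(ℝ, ℝ).prod (𝓡 N)) q} (hv : ∀ w, ambientMetric ε J a o q v w = 0) :
    v = 0 := by
  have hcoord (w : TangentSpace (𝓘(ℝ, ℝ).prod (𝓡 N)) q) :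
      ((ε : ℤ) : ℝ) * (v.1 * w.1) + a q.1 ^ 2 *
        flatMetric N ν ((q.2 : Quadric N ν c).ofPerp v.2) ((q.2 : Quadric N ν c).ofPerp w.2) =
          0 := by
    have hw := hv w
    rwa [ambientMetric_eq_warpForm, mvfderiv_warpIncl_apply, mvfderiv_warpIncl_apply] at hw
  have hfst : v.1 = 0 := by simpa using hcoord ((1, 0) : ℝ × EuclideanSpace ℝ (Fin N))
  have hsnd : v.2 = 0 := eq_zero_of_flatMetric_ofPerp (q.2 : Quadric N ν c) fun y => by
    simpa [ha0] using hcoord ((0, y) : ℝ × EuclideanSpace ℝ (Fin N))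
  exact Prod.ext hfst hsnd

theorem differentiableAt_and_deriv {U : Set ℝ} (hU : IsOpen U) (ha : ContDiffOn ℝ 2 a U) {t : ℝ}
    (ht : t ∈ U) : DifferentiableAt ℝ a t ∧ DifferentiableAt ℝ (deriv a) t :=
  ⟨(ha.contDiffAt (hU.mem_nhds ht)).differentiableAt two_ne_zero,
    ((ha.deriv_of_isOpen (m := 1) hU (by norm_num)).contDiffAt
      (hU.mem_nhds ht)).differentiableAt one_ne_zero⟩

theorem isExtrinsicModel_warpIncl (ha : ContDiffOn ℝ 2 a J) (ha0 : ∀ t ∈ J, a t ≠ 0) :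
    IsExtrinsicModel (𝓘(ℝ, ℝ).prod (𝓡 N)) (ambientMetric ε J a o)
      (warpForm ((ε : ℤ) : ℝ) a (flatMetric N ν))
      (warpChristoffel ((ε : ℤ) : ℝ) ((c : ℤ) : ℝ) a (flatMetric N ν)) (warpIncl J o) := by
  have hda (q : J × spaceForm o) := differentiableAt_and_deriv J.isOpen ha q.1.2
  exact {
    contMDiff := contMDiff_warpIncl
    form_mvfderiv := fun q v w => (ambientMetric_eq_warpForm q v w).symm
    form_symm := fun _ => warpForm_symm (flatMetric_symm N ν)
    christoffel_symm := fun _ => warpChristoffel_symm (flatMetric_symm N ν)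
    differentiableAt_form := fun q => differentiableAt_warpForm (hda q).1
    differentiableAt_christoffel := fun q =>
      differentiableAt_warpChristoffel (hda q).1 (hda q).2 (ha0 q.1 q.1.2)
    fderiv_form := fun q _ v w =>
      fderiv_warpForm_eq_christoffel (flatMetric_symm N ν) (sign_mul_self ε) (hda q).1
        (ha0 q.1 q.1.2) (flatMetric_mvfderiv_warpIncl q v) (flatMetric_mvfderiv_warpIncl q w) }

theorem isTangentialModel_warpIncl (ha : ContDiffOn ℝ 2 a J) (ha0 : ∀ t ∈ J, a t ≠ 0) :
    IsTangentialModel (𝓘(ℝ, ℝ).prod (𝓡 N)) (ambientMetric ε J a o)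
      (warpForm ((ε : ℤ) : ℝ) a (flatMetric N ν))
      (warpChristoffel ((ε : ℤ) : ℝ) ((c : ℤ) : ℝ) a (flatMetric N ν)) (warpIncl J o) where
  __ := isExtrinsicModel_warpIncl ha ha0
  nondegenerate q _ := ambientMetric_nondegenerate (ha0 q.1 q.1.2)
  tangential q _ hS u := mem_range_mvfderiv_warpIncl q <|
    apply_snd_covDerivAlong_snd (sign_mul_self c) (contMDiff_warpIncl.mdifferentiable (by simp) q)
      ((isExtrinsicModel_warpIncl (ε := ε) ha ha0).mdifferentiableAt_mvfderiv hS)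
      (flatMetric_warpIncl q) (fun r => flatMetric_mvfderiv_warpIncl r _)
      (flatMetric_mvfderiv_warpIncl q u)

theorem warpForm_christoffelCurvature_warpIncl (ha : ContDiffOn ℝ 2 a J) (ha0 : ∀ t ∈ J, a t ≠ 0)
    {q : J × spaceForm o} {u v w z : TangentSpace (𝓘(ℝ, ℝ).prod (𝓡 N)) q}
    (hu : ambientMetric ε J a o q z u = 0) (hv : ambientMetric ε J a o q z v = 0) :
    warpForm ((ε : ℤ) : ℝ) a (flatMetric N ν) (warpIncl J o q)
        (christoffelCurvature (warpChristoffel ((ε : ℤ) : ℝ) ((c : ℤ) : ℝ) a (flatMetric N ν))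
          (warpIncl J o q) (mvfderiv (𝓘(ℝ, ℝ).prod (𝓡 N)) (warpIncl J o) q u)
          (mvfderiv (𝓘(ℝ, ℝ).prod (𝓡 N)) (warpIncl J o) q v)
          (mvfderiv (𝓘(ℝ, ℝ).prod (𝓡 N)) (warpIncl J o) q w))
        (mvfderiv (𝓘(ℝ, ℝ).prod (𝓡 N)) (warpIncl J o) q z) =
      (deriv (deriv a) q.1 / a q.1 - deriv a q.1 ^ 2 / a q.1 ^ 2 +
          ((ε : ℤ) : ℝ) * ((c : ℤ) : ℝ) / a q.1 ^ 2) *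
        ambientMetric ε J a o q (partialT (𝓡 N) J q) z *
        (ambientMetric ε J a o q (partialT (𝓡 N) J q) v * ambientMetric ε J a o q u w -
          ambientMetric ε J a o q (partialT (𝓡 N) J q) u * ambientMetric ε J a o q v w) := by
  have hda := differentiableAt_and_deriv J.isOpen ha q.1.2
  have hε := sign_mul_self ε
  rw [ambientMetric_symm, ambientMetric_eq_warpForm] at hu hv
  have hcurv := warpForm_christoffelCurvature (q := warpIncl J o q) (c := ((c : ℤ) : ℝ))
    (w := mvfderiv (𝓘(ℝ, ℝ).prod (𝓡 N)) (warpIncl J o) q w) (flatMetric_symm N ν) hε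
    hda.1 hda.2 (ha0 q.1 q.1.2) (flatMetric_mvfderiv_warpIncl q u)
    (flatMetric_mvfderiv_warpIncl q v) (flatMetric_mvfderiv_warpIncl q z) hu hv
  rw [← ambientMetric_eq_warpForm, ← ambientMetric_eq_warpForm] at hcurv
  have hfst : (warpIncl J o q).1 = q.1 := rfl
  rw [hcurv, hfst]
  simp only [ambientMetric_partialT]
  linear_combination (-(deriv (deriv a) q.1 / a q.1 - deriv a q.1 ^ 2 / a q.1 ^ 2 +
      ((ε : ℤ) : ℝ) * ((c : ℤ) : ℝ) / a q.1 ^ 2) *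
    (mvfderiv (𝓘(ℝ, ℝ).prod (𝓡 N)) (warpIncl J o) q z).1 *
    ((mvfderiv (𝓘(ℝ, ℝ).prod (𝓡 N)) (warpIncl J o) q v).1 * ambientMetric ε J a o q u w -
      (mvfderiv (𝓘(ℝ, ℝ).prod (𝓡 N)) (warpIncl J o) q u).1 * ambientMetric ε J a o q v w)) * hε

end WarpedProduct

section WarpedImmersion

variable {N ν : ℕ} {ε c : ℤˣ} {J : TopologicalSpace.Opens ℝ} {o : Quadric N ν c} {a : ℝ → ℝ}
  {E : Type*} [NormedAddCommGroup E] [NormedSpace ℝ E] [FiniteDimensional ℝ E]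
  {H : Type*} [TopologicalSpace H] {I : ModelWithCorners ℝ E H}
  {M : Type*} [TopologicalSpace M] [ChartedSpace H M] [IsManifold I ∞ M]
  {g : SemiRiemannianMetric I M} {f : M → J × spaceForm o} {x : M}

theorem inner_tangentT (hf : MDifferentiableAt I (𝓘(ℝ, ℝ).prod (𝓡 N)) f x)
    (u : TangentSpace I x) :
    g.inner x (tangentT ε g f x) u =
      ambientMetric ε J a o (f x) (partialT (𝓡 N) J (f x))
        (mfderiv I (𝓘(ℝ, ℝ).prod (𝓡 N)) f x u) := by
  have hfst : MDifferentiableAt (𝓘(ℝ, ℝ).prod (𝓡 N)) 𝓘(ℝ, ℝ)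
      (fun q : J × spaceForm o => (q.1 : ℝ)) (f x) :=
    (contMDiff_subtype_val.comp contMDiff_fst).mdifferentiableAt one_ne_zero
  rw [ambientMetric_partialT, tangentT, SemiRiemannianMetric.grad, map_smul, smul_apply,
    g.inner_sharp, smul_eq_mul, mvfderiv_fun_comp_apply hfst hf, mvfderiv_fst_val,
    mvfderiv_warpIncl_apply]

theorem ambientMetric_normalXi {w : TangentSpace (𝓘(ℝ, ℝ).prod (𝓡 N)) (f x)}
    (hw : IsNormal (I := I) (ambientMetric ε J a o) f x w) :
    ambientMetric ε J a o (f x) (normalXi (𝓡 N) ε g f x) w =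
      ambientMetric ε J a o (f x) (partialT (𝓡 N) J (f x)) w := by
  have htangent : ambientMetric ε J a o (f x)
      (mfderiv I (𝓘(ℝ, ℝ).prod (𝓡 N)) f x (tangentT ε g f x)) w = 0 := by
    rw [ambientMetric_symm, hw]
  rw [normalXi, map_sub, sub_apply, htangent, sub_zero]

end WarpedImmersion

end WarpedCodazzi

end

theorem proposition3p3_general
    {N ν : ℕ} {ε c : ℤˣ} {o : Quadric N ν c} {J : TopologicalSpace.Opens ℝ}
    {a : ℝ → ℝ} (ha : ContDiffOn ℝ 2 a J) (ha0 : ∀ t ∈ J, a t ≠ 0)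
    {E : Type*} [NormedAddCommGroup E] [NormedSpace ℝ E] [FiniteDimensional ℝ E]
    {H : Type*} [TopologicalSpace H] {I : ModelWithCorners ℝ E H}
    {M : Type*} [TopologicalSpace M] [ChartedSpace H M] [IsManifold I ∞ M]
    {g : SemiRiemannianMetric I M} {f : M → J × spaceForm o}
    (hf : IsIsometricImmersion g (ambientMetric ε J a o) f)
    {D : CovariantDerivative I E (TangentSpace I : M → Type _)} (hD : IsLeviCivita g.inner D)
    {Dbar : CovariantDerivative (𝓘(ℝ, ℝ).prod (𝓡 N)) (ℝ × EuclideanSpace ℝ (Fin N))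
      (TangentSpace (𝓘(ℝ, ℝ).prod (𝓡 N)) : J × spaceForm o → Type _)}
    (hDbar : IsLeviCivita (ambientMetric ε J a o) Dbar)
    {x : M} {X Y Z : ∀ y : M, TangentSpace I y}
    (hX : MDifferentiableAt I I.tangent (fun y => (⟨y, X y⟩ : TangentBundle I M)) x)
    (hY : MDifferentiableAt I I.tangent (fun y => (⟨y, Y y⟩ : TangentBundle I M)) x)
    (hZ : ContMDiffAt I I.tangent 2 (fun y => (⟨y, Z y⟩ : TangentBundle I M)) x)
    {η : ∀ y : M, TangentSpace (𝓘(ℝ, ℝ).prod (𝓡 N)) (f y)}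
    (hη : MDifferentiableAt I (𝓘(ℝ, ℝ).prod (𝓡 N)).tangent
      (fun y => (⟨f y, η y⟩ : TangentBundle (𝓘(ℝ, ℝ).prod (𝓡 N)) (J × spaceForm o))) x)
    (hη_normal : ∀ᶠ y in 𝓝 x, IsNormal (I := I) (ambientMetric ε J a o) f y (η y)) :
    covDerivSecondFundamentalForm g (ambientMetric ε J a o) Dbar f D Y X Z η x -
        covDerivSecondFundamentalForm g (ambientMetric ε J a o) Dbar f D X Y Z η x =
      (deriv (deriv a) (f x).1 / a (f x).1 - deriv a (f x).1 ^ 2 / a (f x).1 ^ 2 +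
          ((ε : ℤ) : ℝ) * ((c : ℤ) : ℝ) / a (f x).1 ^ 2) *
        (ambientMetric ε J a o) (f x) (normalXi (𝓡 N) ε g f x) (η x) *
        (g.inner x (tangentT ε g f x) (X x) * g.inner x (Y x) (Z x) -
          g.inner x (tangentT ε g f x) (Y x) * g.inner x (X x) (Z x)) := by
  have hnormal := hη_normal.self_of_nhds
  rw [covDerivSecondFundamentalForm_sub (isTangentialModel_warpIncl ha ha0) hf hDbar hD hX hY hZ hη
      hη_normal, warpForm_christoffelCurvature_warpIncl ha ha0 (hnormal (Y x)) (hnormal (X x)),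
    hf.2, hf.2, inner_tangentT (hf.1.mdifferentiableAt (by simp)),
    inner_tangentT (hf.1.mdifferentiableAt (by simp)), ambientMetric_normalXi hnormal]

theorem proposition3p3
    {N n l : ℕ} (hN : 2 ≤ N) (hl : l ≤ N) (ε c : ℤˣ)
    -- the space form: the component of the hyperquadric through the point `o`
    (o : Quadric N (ambientIndex l c) c)
    -- the interval and the scale factor
    (J : TopologicalSpace.Opens ℝ) (hJ : (J : Set ℝ).OrdConnected)
    (a : ℝ → ℝ) (ha : ContDiffOn ℝ ∞ a J) (ha_pos : ∀ t ∈ J, 0 < a t)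
    -- the semi-Riemannian manifold and its isometric immersion into the warped product
    {M : Type*} [TopologicalSpace M] [ChartedSpace (EuclideanSpace ℝ (Fin n)) M]
    [IsManifold (𝓡 n) ∞ M] (g : SemiRiemannianMetric (𝓡 n) M)
    (f : M → J × spaceForm o) (hf : IsIsometricImmersion g (ambientMetric ε J a o) f)
    -- the Levi-Civita connections of the manifold and of the warped product
    (D : CovariantDerivative (𝓡 n) (EuclideanSpace ℝ (Fin n)) (TangentSpace (𝓡 n) : M → Type _))
    (hD : IsLeviCivita g.inner D)
    (Dbar : CovariantDerivative (𝓘(ℝ, ℝ).prod (𝓡 N)) (ℝ × EuclideanSpace ℝ (Fin N))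
      (TangentSpace (𝓘(ℝ, ℝ).prod (𝓡 N)) : J × spaceForm o → Type _))
    (hDbar : IsLeviCivita (ambientMetric ε J a o) Dbar)
    -- vector fields and a normal field, smooth around the point `x`
    (x : M) (X Y Z : ∀ y : M, TangentSpace (𝓡 n) y)
    (hX : ContMDiffAt (𝓡 n) (𝓡 n).tangent ∞ (fun y => (⟨y, X y⟩ : TangentBundle (𝓡 n) M)) x)
    (hY : ContMDiffAt (𝓡 n) (𝓡 n).tangent ∞ (fun y => (⟨y, Y y⟩ : TangentBundle (𝓡 n) M)) x)
    (hZ : ContMDiffAt (𝓡 n) (𝓡 n).tangent ∞ (fun y => (⟨y, Z y⟩ : TangentBundle (𝓡 n) M)) x)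
    (η : ∀ y : M, TangentSpace (𝓘(ℝ, ℝ).prod (𝓡 N)) (f y))
    (hη : ContMDiffAt (𝓡 n) (𝓘(ℝ, ℝ).prod (𝓡 N)).tangent ∞
      (fun y => (⟨f y, η y⟩ : TangentBundle (𝓘(ℝ, ℝ).prod (𝓡 N)) (J × spaceForm o))) x)
    (hη_normal : ∀ᶠ y in 𝓝 x, IsNormal (I := 𝓡 n) (ambientMetric ε J a o) f y (η y)) :
    covDerivSecondFundamentalForm g (ambientMetric ε J a o) Dbar f D Y X Z η x -
        covDerivSecondFundamentalForm g (ambientMetric ε J a o) Dbar f D X Y Z η x =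
      (deriv (deriv a) (f x).1 / a (f x).1 - deriv a (f x).1 ^ 2 / a (f x).1 ^ 2 +
          ((ε : ℤ) : ℝ) * ((c : ℤ) : ℝ) / a (f x).1 ^ 2) *
        (ambientMetric ε J a o) (f x) (normalXi (𝓡 N) ε g f x) (η x) *
        (g.inner x (tangentT ε g f x) (X x) * g.inner x (Y x) (Z x) -
          g.inner x (tangentT ε g f x) (Y x) * g.inner x (X x) (Z x)) :=
  proposition3p3_general (ha.of_le ENat.LEInfty.out) (fun t ht => (ha_pos t ht).ne') hf hD
    hDbar (hX.mdifferentiableAt (by simp)) (hY.mdifferentiableAt (by simp))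
    (hZ.of_le ENat.LEInfty.out) (hη.mdifferentiableAt (by simp)) hη_normal
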